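/- **Conventions.** All schemes are over $\mathbb C$. Let $X$ be a separated scheme of finite type over $\mathbb C$ and let $r\ge 0$ be an integer. For $n\ge 0$ let $\mathcal M_{n,r}(X)$ be the monoid, under disjoint union of domains, of isomorphism classes $[f:Y\to X,E]$ of pairs consisting of a projective morphism $f:Y\to X$ from a smooth quasi-projective scheme $Y$ of pure dimension $n$ and a vector bundle $E$ of rank $r$ on $Y$; an isomorphism $(f:Y\to X,E)\to(f':Y'\to X,E')$ is an isomorphism $\phi:Y\to Y'$ of $X$-schemes together with an isomorphism $E\cong\phi^*E'$. Let $\mathcal M_{n,r}(X)^+$ be its group completion. A *double point relation* over $X$ is given by a smooth quasi-projective scheme $V$ of pure dimension $n+1$, a vector bundle $E$ of rank $r$ on $V$, and a projective morphism $g:V\to X\times\mathbb P^1$ such that, for $\pi=\mathrm{pr}_2\circ g$, one has $\pi^{-1}(0)=A\cup B$ with $A,B\subset V$ smooth closed subschemes of codimension one meeting transversely. Put $D=A\cap B$ and $\mathbb P(\pi)=\mathbb P(\mathcal O_D\oplus N_{D/A})\to D$, where $N_{D/A}$ is the normal bundle of $D$ in $A$. ($A$, $B$, $D$ may be empty or disconnected.)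 For a regular value $\zeta\in\mathbb P^1(\mathbb C)$ of $\pi$ with fibre $V_\zeta=\pi^{-1}(\zeta)$ the relation is the element $$[V_\zeta\to X,E|_{V_\zeta}]-[A\to X,E|_A]-[B\to X,E|_B]+[\mathbb P(\pi)\to X,E|_{\mathbb P(\pi)}]\in\mathcal M_{n,r}(X)^+,$$ where the morphisms to $X$ are induced by $\mathrm{pr}_1\circ g$ and $E|_{\mathbb P(\pi)}$ is the pullback of $E$ along $\mathbb P(\pi)\to D\subset V$. Let $\omega_{n,r}(X)$ be the quotient of $\mathcal M_{n,r}(X)^+$ by the subgroup generated by all double point relations, and let $\omega_{*,r}(X)=\bigoplus_{n\ge0}\omega_{n,r}(X)$. The same construction over $X=\operatorname{Spec}\mathbb C$ without bundles gives $\omega_*(\mathbb C)$, a commutative ring under $[Z]\cdot[Z']=[Z\times Z']$; and $\omega_{*,r}(X)$ is an $\omega_*(\mathbb C)$-module by $[Z]\cdot[f:Y\to X,E]=[f\circ\mathrm{pr}_Y:Z\times Y\to X,\ \mathrm{pr}_Y^*E]$. **Proposition 2.2 (compatibility with dualization).** Sending $(f:Y\to X,E)$ to $(f:Y\to X,E^\vee)$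 induces an involution of the group and $\omega_*(\mathbb C)$-module $\omega_{*,r}(X)$: there is an automorphism $\tau$ of the $\omega_*(\mathbb C)$-module $\omega_{*,r}(X)$ with $$\tau\big([f:Y\to X,E]\big)=[f:Y\to X,E^\vee]\quad\text{for all }(f:Y\to X,E),\qquad \tau\circ\tau=\mathrm{id}.$$ In particular, if for finitely many integers $a_i,b_j$ one has $$\sum_i a_i\,[f_i:Y_i\to X,E_i]=\sum_j b_j\,[g_j:Z_j\to X,F_j]\quad\text{in }\omega_{*,r}(X),$$ then $$\sum_i a_i\,[f_i:Y_i\to X,E_i^\vee]=\sum_j b_j\,[g_j:Z_j\to X,F_j^\vee]\quad\text{in }\omega_{*,r}(X).$$ -/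

import Mathlib

open CategoryTheory CategoryTheory.Limits AlgebraicGeometry

namespace BundleCobordism

/-- Restriction of functions from an open set to a smaller one. -/
noncomputable abbrev res {Y : Scheme.{0}} {V U : Y.Opens} (h : V ≤ U) : Γ(Y, U) →+* Γ(Y, V) :=
  (Y.presheaf.map (homOfLE h).op).hom

/-- Pullback of functions along a morphism. -/
noncomputable abbrev pull {T Y : Scheme.{0}} (f : T ⟶ Y) (U : Y.Opens) :
    Γ(Y, U) →+* Γ(T, f ⁻¹ᵁ U) :=
  (f.app U).hom

/-- Restriction of invertible matrices of functions. -/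
noncomputable abbrev resGL {Y : Scheme.{0}} {r : ℕ} {V U : Y.Opens} (h : V ≤ U) :
    GL (Fin r) Γ(Y, U) →* GL (Fin r) Γ(Y, V) :=
  Matrix.GeneralLinearGroup.map (res h)

/-- Pullback of invertible matrices of functions. -/
noncomputable abbrev pullGL {T Y : Scheme.{0}} {r : ℕ} (f : T ⟶ Y) (U : Y.Opens) :
    GL (Fin r) Γ(Y, U) →* GL (Fin r) Γ(T, f ⁻¹ᵁ U) :=
  Matrix.GeneralLinearGroup.map (pull f U)

/-- A vector bundle of rank `r` on `Y`, given by transition functions: an open cover `U i` and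
matrices `g i j ∈ GL_r(𝒪(U i ∩ U j))` with `g i k = g i j * g j k` on triple overlaps.  Its sections
over an open set `O` are the families of columns `v i ∈ 𝒪(U i ∩ O)^r` with `v i = g i j * v j`.
Every locally free sheaf of constant rank `r` arises in this way, and bundles are compared by
`VecBundle.IsIsomorphic` below. -/
structure VecBundle (Y : Scheme.{0}) (r : ℕ) where
  /-- the index set of the cover -/
  I : Type
  /-- the trivializing open sets -/
  U : I → Y.Opens
  covers : ∀ y : Y, ∃ i, y ∈ U i
  /-- the transition functions -/
  g : ∀ i j, GL (Fin r) Γ(Y, U i ⊓ U j)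
  cocycle : ∀ i j k,
    resGL (V := U i ⊓ U j ⊓ U k) (inf_le_inf_right _ inf_le_left) (g i k) =
      resGL inf_le_left (g i j) * resGL (inf_le_inf_right _ inf_le_right) (g j k)

theorem res_res {Y : Scheme.{0}} {W V U : Y.Opens} (h : W ≤ V) (h' : V ≤ U) (a : Γ(Y, U)) :
    res h (res h' a) = res (h.trans h') a := by
  change ((Y.presheaf.map _) ≫ (Y.presheaf.map _)).hom a = _
  rw [← Functor.map_comp]; rfl

theorem resGL_resGL {Y : Scheme.{0}} {r : ℕ} {W V U : Y.Opens} (h : W ≤ V) (h' : V ≤ U)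
    (a : GL (Fin r) Γ(Y, U)) :
    resGL h (resGL h' a) = resGL (h.trans h') a := by
  ext i j; exact res_res h h' _

theorem res_pull {T Y : Scheme.{0}} (f : T ⟶ Y) {V U : Y.Opens} (h : V ≤ U) (a : Γ(Y, U)) :
    pull f V (res h a) = res (f.preimage_mono h) (pull f U a) := by
  change (Y.presheaf.map _ ≫ f.app V).hom a = (f.app U ≫ T.presheaf.map _).hom a
  rw [f.naturality]; rfl

theorem pullGL_resGL {T Y : Scheme.{0}} {r : ℕ} (f : T ⟶ Y) {V U : Y.Opens} (h : V ≤ U)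
    (a : GL (Fin r) Γ(Y, U)) :
    pullGL f V (resGL h a) = resGL (f.preimage_mono h) (pullGL f U a) := by
  ext i j; exact res_pull f h _

/-- The contragredient `g ↦ (g⁻¹)ᵀ` of an invertible matrix. -/
def contra {R : Type*} [CommRing R] {r : ℕ} : GL (Fin r) R →* GL (Fin r) R where
  toFun g := ⟨((g⁻¹ : GL (Fin r) R) : Matrix (Fin r) (Fin r) R).transpose,
    (g : Matrix (Fin r) (Fin r) R).transpose,
    by rw [← Matrix.transpose_mul]; simp, by rw [← Matrix.transpose_mul]; simp⟩
  map_one' := by ext1; simp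
  map_mul' g h := by ext1; simp [Matrix.transpose_mul]

theorem map_contra {R S : Type*} [CommRing R] [CommRing S] {r : ℕ} (φ : R →+* S)
    (g : GL (Fin r) R) :
    Matrix.GeneralLinearGroup.map φ (contra g) = contra (Matrix.GeneralLinearGroup.map φ g) := by
  have h : (Matrix.GeneralLinearGroup.map φ g)⁻¹ = Matrix.GeneralLinearGroup.map φ g⁻¹ := by
    rw [map_inv]
  ext i j
  change φ ((g⁻¹ : GL (Fin r) R).val j i) = ((Matrix.GeneralLinearGroup.map φ g)⁻¹).val j i
  rw [h]; rfl

namespace VecBundle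
/-- The pullback `f^* E`: pull back the cover and the transition functions. -/
noncomputable def pullback {T Y : Scheme.{0}} {r : ℕ} (f : T ⟶ Y) (E : VecBundle Y r) :
    VecBundle T r where
  I := E.I
  U i := f ⁻¹ᵁ E.U i
  covers t := E.covers (f t)
  g i j := pullGL f _ (E.g i j)
  cocycle i j k := by
    have := congrArg (pullGL f _) (E.cocycle i j k)
    rw [map_mul, pullGL_resGL, pullGL_resGL, pullGL_resGL] at this
    exact this

theorem pullback_comp {T Y Z : Scheme.{0}} {r : ℕ} (f : T ⟶ Y) (h : Y ⟶ Z) (E : VecBundle Z r) :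
    pullback (f ≫ h) E = pullback f (pullback h E) := by
  rfl


/-- The dual bundle `E^∨`: its transition functions are the inverse transposes of those of `E`. -/
def dual {Y : Scheme.{0}} {r : ℕ} (E : VecBundle Y r) : VecBundle Y r where
  I := E.I
  U := E.U
  covers := E.covers
  g i j := contra (E.g i j)
  cocycle i j k := by
    simp only [resGL, map_contra]
    rw [← map_mul]
    exact congrArg contra (E.cocycle i j k)

/-- Isomorphism of vector bundles `F ≅ E`: on `E.U i ∩ F.U a` it is given in the two trivializations
by an invertible matrix `h i a`, sending the column `w a` of a section of `F` to `v i = h i a * w a`,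
and these matrices are compatible with the transition functions. -/
def IsIsomorphic {Y : Scheme.{0}} {r : ℕ} (E F : VecBundle Y r) : Prop :=
  ∃ h : ∀ (i : E.I) (a : F.I), GL (Fin r) Γ(Y, E.U i ⊓ F.U a),
    ∀ (i j : E.I) (a b : F.I),
      resGL (V := E.U i ⊓ E.U j ⊓ (F.U a ⊓ F.U b)) inf_le_left (E.g i j) *
          resGL (inf_le_inf inf_le_right inf_le_right) (h j b) =
        resGL (inf_le_inf inf_le_left inf_le_left) (h i a) * resGL inf_le_right (F.g a b)

theorem IsIsomorphic.refl {Y : Scheme.{0}} {r : ℕ} (E : VecBundle Y r) :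
    IsIsomorphic E E := by
  refine ⟨fun i a => E.g i a, fun i j a b => ?_⟩
  have h1 := congrArg (resGL (V := E.U i ⊓ E.U j ⊓ (E.U a ⊓ E.U b))
    (le_inf inf_le_left (inf_le_right.trans inf_le_right))) (E.cocycle i j b)
  have h2 := congrArg (resGL (V := E.U i ⊓ E.U j ⊓ (E.U a ⊓ E.U b))
    (le_inf (le_inf (inf_le_left.trans inf_le_left) (inf_le_right.trans inf_le_left))
      (inf_le_right.trans inf_le_right))) (E.cocycle i a b)
  simp only [map_mul, resGL_resGL] at h1 h2
  exact h1.symm.trans h2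

theorem IsIsomorphic.pullback {T Y : Scheme.{0}} {r : ℕ} (f : T ⟶ Y) {E F : VecBundle Y r}
    (h : IsIsomorphic E F) : IsIsomorphic (E.pullback f) (F.pullback f) := by
  obtain ⟨h, hh⟩ := h
  refine ⟨fun i a => pullGL f _ (h i a), fun i j a b => ?_⟩
  have := congrArg (pullGL f _) (hh i j a b)
  simp only [map_mul, pullGL_resGL] at this
  exact this

/-- The transition function of a line bundle, as an (invertible) function. -/
noncomputable def u {Y : Scheme.{0}} (L : VecBundle Y 1) (i j : L.I) : Γ(Y, L.U i ⊓ L.U j) :=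
  (L.g i j : Matrix (Fin 1) (Fin 1) _) 0 0

/-- The block matrix `diag (1, A)` for a `1 × 1` matrix `A`. -/
def oneBlock (R : Type*) [CommRing R] : Matrix (Fin 1) (Fin 1) R →* Matrix (Fin 2) (Fin 2) R where
  toFun A := !![1, 0; 0, A 0 0]
  map_one' := by ext i j; fin_cases i <;> fin_cases j <;> simp
  map_mul' A B := by
    ext i j; fin_cases i <;> fin_cases j <;> simp [Matrix.mul_apply]

theorem map_oneBlock {R S : Type*} [CommRing R] [CommRing S] (φ : R →+* S) (g : GL (Fin 1) R) :
    Matrix.GeneralLinearGroup.map φ (Units.map (oneBlock R) g) =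
      Units.map (oneBlock S) (Matrix.GeneralLinearGroup.map φ g) := by
  ext i j
  change φ (oneBlock R g.val i j) = oneBlock S _ i j
  fin_cases i <;> fin_cases j <;> simp [oneBlock]

/-- The rank two bundle `𝒪 ⊕ N` for a line bundle `N`. -/
noncomputable def onePlus {Y : Scheme.{0}} (N : VecBundle Y 1) : VecBundle Y 2 where
  I := N.I
  U := N.U
  covers := N.covers
  g i j := Units.map (oneBlock _) (N.g i j)
  cocycle i j k := by
    simp only [resGL, map_oneBlock]
    rw [← map_mul]
    exact congrArg (Units.map (oneBlock _)) (N.cocycle i j k)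

end VecBundle

/-- A section over the open set `O` of the tensor power `L^{⊗ k}` of a line bundle. -/
structure PowSection {Y : Scheme.{0}} (L : VecBundle Y 1) (k : ℕ) (O : Y.Opens) where
  s : ∀ i, Γ(Y, L.U i ⊓ O)
  compat : ∀ i j, res (V := L.U i ⊓ L.U j ⊓ O) (inf_le_inf_right _ inf_le_left) (s i) =
    res inf_le_left (L.u i j) ^ k * res (inf_le_inf_right _ inf_le_right) (s j)

/-- The open subset of `O` where a section of `L^{⊗ k}` over `O` does not vanish. -/
def PowSection.nonvanishing {Y : Scheme.{0}} {L : VecBundle Y 1} {k : ℕ} {O : Y.Opens}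
    (σ : PowSection L k O) : Y.Opens := ⨆ i, Y.basicOpen (σ.s i)

/-- The line bundle `L` on `Y` is `f`-ample: `X` is covered by affine open sets `V` such that `L` is
ample on `f⁻¹(V)`, i.e. every point of `f⁻¹(V)` lies in an affine open set of the form `s ≠ 0` with
`s` a section of a positive tensor power of `L` over `f⁻¹(V)`. (It is only used for
quasi-compact `f`.) -/
def RelativelyAmple {Y X : Scheme.{0}} (f : Y ⟶ X) (L : VecBundle Y 1) : Prop :=
  ∀ x : X, ∃ V : X.Opens, x ∈ V ∧ IsAffineOpen V ∧
    ∀ y ∈ f ⁻¹ᵁ V, ∃ k > 0, ∃ σ : PowSection L k (f ⁻¹ᵁ V),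
      y ∈ σ.nonvanishing ∧ IsAffineOpen σ.nonvanishing

/-- Quasi-projective morphisms: of finite type, with a relatively ample line bundle. (Such a
morphism is separated.) Over `Spec ℂ` these are the locally closed subschemes of projective
spaces. -/
class IsQuasiProjective {Y X : Scheme.{0}} (f : Y ⟶ X) : Prop where
  locallyOfFiniteType : LocallyOfFiniteType f
  quasiCompact : QuasiCompact f
  exists_ample : ∃ L : VecBundle Y 1, RelativelyAmple f L

/-- Projective morphisms: proper, with a relatively ample line bundle. If `X` is of finite type and
separated over `ℂ`, and `Y` is quasi-projective over `ℂ`, this means that `f` factors as a closed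
immersion `Y → X × ℙᴺ` followed by the projection. -/
class IsProjective {Y X : Scheme.{0}} (f : Y ⟶ X) : Prop where
  isProper : IsProper f
  exists_ample : ∃ L : VecBundle Y 1, RelativelyAmple f L

/-- `Spec ℂ`. -/
noncomputable abbrev SpecC : Scheme.{0} := Spec (.of ℂ)
/-- `Spec ℂ` as a `ℂ`-scheme. -/
noncomputable abbrev pt : Over SpecC := Over.mk (𝟙 SpecC)

attribute [local instance] MvPolynomial.gradedAlgebra
/-- The projective line `Proj ℂ[X₀, X₁]`. -/
noncomputable abbrev P1Scheme : Scheme.{0} := Proj (MvPolynomial.homogeneousSubmodule (Fin 2) ℂ)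

/-- The projective line as a `ℂ`-scheme. -/
noncomputable def P1 : Over SpecC := Over.mk
  (Y := P1Scheme) (Proj.toSpecZero (MvPolynomial.homogeneousSubmodule (Fin 2) ℂ) ≫
    Spec.map (CommRingCat.ofHom (algebraMap ℂ
      (MvPolynomial.homogeneousSubmodule (Fin 2) ℂ 0))))


/-- The `ℂ`-point `z` of `ℙ¹` is the origin `0 = [0 : 1]`, i.e. the one where `X₀` vanishes. -/
def IsOrigin (z : SpecC ⟶ P1.left) : Prop :=
  z ≫ P1.hom = 𝟙 SpecC ∧
    z ⁻¹ᵁ Proj.basicOpen (MvPolynomial.homogeneousSubmodule (Fin 2) ℂ) (MvPolynomial.X 0) = ⊥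

/-- `X × ℙ¹` (over `ℂ`). -/
noncomputable abbrev timesP1 (X : Over SpecC) : Over SpecC :=
  Over.mk (Limits.pullback.fst X.hom P1.hom ≫ X.hom)

/-- The projection `X × ℙ¹ → X`. -/
noncomputable abbrev prX (X : Over SpecC) : (timesP1 X).left ⟶ X.left :=
  Limits.pullback.fst X.hom P1.hom

/-- The projection `X × ℙ¹ → ℙ¹`. -/
noncomputable abbrev prP1 (X : Over SpecC) : (timesP1 X).left ⟶ P1.left :=
  Limits.pullback.snd X.hom P1.hom

/-- For a (closed) subscheme `a : A → V`: inside the open set `W`, it is the closed subscheme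
`e = 0`. In terms of points: a morphism `t : T → W` factors through `A` iff `t^* e = 0`. -/
def CutsOut {A V : Scheme.{0}} (a : A ⟶ V) (W : V.Opens) (e : Γ(V, W)) : Prop :=
  ∀ (T : Scheme.{0}) (t : T ⟶ V), t ⁻¹ᵁ W = ⊤ → ((∃ l : T ⟶ A, l ≫ a = t) ↔ pull t W e = 0)

/-- `N` is the normal bundle `𝒪_A(D)|_D` of a closed subscheme `i : D → A` of codimension one of a
smooth scheme. Here `L = 𝒪_A(D)` is described by local equations `e k` of `D`: its transition
functions are the quotients `e k / e l`. (Local equations of such a `D` are nonzerodivisors, so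
that these quotients are determined by `D`.) -/
def IsNormalBundle {D A : Scheme.{0}} (i : D ⟶ A) (N : VecBundle D 1) : Prop :=
  ∃ (L : VecBundle A 1) (e : ∀ k, Γ(A, L.U k)),
    (∀ k, CutsOut i (L.U k) (e k)) ∧
    (∀ k l, res (V := L.U k ⊓ L.U l) inf_le_left (e k) = L.u k l * res inf_le_right (e l)) ∧
    N.IsIsomorphic (L.pullback i)

/-- A line subbundle (a rank one subbundle) of `t^* E`, for `t : T → D`. On the members `V a` of an
open cover it is spanned by a section of `t^* E`, which is given in the trivializations of `E` by
columns `m i a` of functions without common zeros. The spanning sections on `V a` and on `V b`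
differ by an invertible function. -/
structure LineSubbundle {D T : Scheme.{0}} {r : ℕ} (E : VecBundle D r) (t : T ⟶ D) where
  J : Type
  V : J → T.Opens
  covers : ∀ y : T, ∃ a, y ∈ V a
  m : ∀ (i : E.I) (a : J), Fin r → Γ(T, t ⁻¹ᵁ E.U i ⊓ V a)
  compat : ∀ i j a (k : Fin r),
    res (V := t ⁻¹ᵁ (E.U i ⊓ E.U j) ⊓ V a)
        (inf_le_inf_right _ (t.preimage_mono inf_le_left)) (m i a k) =
      ∑ l, res inf_le_left (pull t _ ((E.g i j : Matrix (Fin r) (Fin r) _) k l)) *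
        res (inf_le_inf_right _ (t.preimage_mono inf_le_right)) (m j a l)
  nowhere_zero : ∀ i a, t ⁻¹ᵁ E.U i ⊓ V a ≤ ⨆ k, T.basicOpen (m i a k)
  proportional : ∀ i a b, ∃ c : Γ(T, t ⁻¹ᵁ E.U i ⊓ (V a ⊓ V b))ˣ, ∀ k,
    res (inf_le_inf_left _ inf_le_left) (m i a k) =
      c.val * res (inf_le_inf_left _ inf_le_right) (m i b k)

/-- The line subbundle `σ` of `t^* E` is the pullback along `u : T → P`, where `u ≫ q = t`, of the
line subbundle `τ` of `q^* E`: locally their spanning sections differ by an invertible function. -/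
def LineSubbundle.IsPullbackAlong {D P T : Scheme.{0}} {r : ℕ} {E : VecBundle D r} {q : P ⟶ D}
    (τ : LineSubbundle E q) (u : T ⟶ P) {t : T ⟶ D} (σ : LineSubbundle E t) : Prop :=
  ∀ i a b, ∃ c : Γ(T, u ⁻¹ᵁ (q ⁻¹ᵁ E.U i ⊓ τ.V a) ⊓ (t ⁻¹ᵁ E.U i ⊓ σ.V b))ˣ, ∀ k,
    res inf_le_left (pull u _ (τ.m i a k)) = c.val * res inf_le_right (σ.m i b k)

/-- `q : P → D` is the projective bundle `ℙ(E) → D` of lines in `E`: it carries a universal line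
subbundle `τ` of `q^* E`. -/
def IsProjectivization {D P : Scheme.{0}} {r : ℕ} (E : VecBundle D r) (q : P ⟶ D) : Prop :=
  ∃ τ : LineSubbundle E q, ∀ (T : Scheme.{0}) (t : T ⟶ D) (σ : LineSubbundle E t),
    ∃! u : T ⟶ P, u ≫ q = t ∧ τ.IsPullbackAlong u σ

/-- The objects `(f : Y → X, (E_i)_i)`: a smooth quasi-projective `ℂ`-scheme `Y` of pure dimension
`dim`, a projective morphism `f`, and a list of vector bundles `E_i` on `Y` of ranks `r_i`.
The list `![]` gives the objects `f : Y → X` without bundles, and `![r]` the objects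
`(f : Y → X, E)` with one bundle of rank `r`. -/
structure Cycle (X : Over SpecC) {s : ℕ} (r : Fin s → ℕ) where
  dim : ℕ
  Y : Scheme.{0}
  f : Y ⟶ X.left
  smooth : SmoothOfRelativeDimension dim (f ≫ X.hom)
  quasiProjective : IsQuasiProjective (f ≫ X.hom)
  projective : IsProjective f
  E : ∀ i, VecBundle Y (r i)

namespace Cycle
variable {X : Over SpecC} {s : ℕ} {r : Fin s → ℕ}

/-- The structure morphism `Y → Spec ℂ`. -/
noncomputable abbrev str (M : Cycle X r) : M.Y ⟶ SpecC := M.f ≫ X.hom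

/-- Dualize the bundles: `(f : Y → X, E) ↦ (f : Y → X, E^∨)`. -/
def dual (M : Cycle X r) : Cycle X r := { M with E := fun i => (M.E i).dual }

/-- Isomorphisms: an isomorphism `φ` of `X`-schemes and isomorphisms of `E_i` with `φ^* E'_i`. -/
def IsIsomorphic (M N : Cycle X r) : Prop :=
  ∃ φ : M.Y ≅ N.Y, φ.hom ≫ N.f = M.f ∧ ∀ i, (M.E i).IsIsomorphic ((N.E i).pullback φ.hom)

/-- `M` is the disjoint union of `N₁` and `N₂`. -/
def IsDisjointUnion (M N₁ N₂ : Cycle X r) : Prop :=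
  ∃ (j₁ : N₁.Y ⟶ M.Y) (j₂ : N₂.Y ⟶ M.Y) (_ : IsOpenImmersion j₁) (_ : IsOpenImmersion j₂),
    IsCompl j₁.opensRange j₂.opensRange ∧ N₁.f = j₁ ≫ M.f ∧ N₂.f = j₂ ≫ M.f ∧
    (∀ i, (N₁.E i).IsIsomorphic ((M.E i).pullback j₁)) ∧
    (∀ i, (N₂.E i).IsIsomorphic ((M.E i).pullback j₂))

/-- `N` is obtained from the family `V` over `X × ℙ¹` by restricting along `k`. -/
def IsRestriction (N : Cycle X r) (V : Cycle (timesP1 X) r) (k : N.Y ⟶ V.Y) : Prop :=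
  N.f = k ≫ V.f ≫ prX X ∧
    ∀ i, (N.E i).IsIsomorphic ((V.E i).pullback k)
end Cycle

/-- The geometry of a double point relation, for `π : V → ℙ¹` with `V` of dimension `n + 1`, smooth
`a : A → V`, `b : B → V` of dimension `n`, the bundle `P = ℙ(π)`, and a smooth fibre `c : F → V`. -/
structure DoublePointGeometry {V A B P F : Scheme.{0}} (n : ℕ) (str : V ⟶ SpecC)
    (π : V ⟶ P1.left) (a : A ⟶ V) (b : B ⟶ V) (p : P ⟶ V) (c : F ⟶ V) : Prop where
  closed_a : IsClosedImmersion a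
  closed_b : IsClosedImmersion b
  /-- `π⁻¹(0) = A ∪ B`: in local equations, `A` is `α = 0`, `B` is `β = 0`, and the scheme-theoretic
  fibre `Z = π⁻¹(0)` is `α β = 0`. -/
  union : ∃ (z : SpecC ⟶ P1.left) (Z : Scheme.{0}) (i : Z ⟶ V) (w : Z ⟶ SpecC),
    IsOrigin z ∧ IsPullback i w π z ∧
    ∀ y : V, ∃ (W : V.Opens) (α β : Γ(V, W)), y ∈ W ∧
      CutsOut a W α ∧ CutsOut b W β ∧ CutsOut i W (α * β)
  /-- `A` and `B` meet transversely: the scheme-theoretic intersection `D = A ×_V B` is smooth of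
  dimension `n - 1` (empty if `n = 0`). Moreover `P = ℙ(𝒪_D ⊕ N_{D/A})`, mapped to `V` through
  `D`. -/
  bundle : ∃ (D : Scheme.{0}) (i : D ⟶ A) (j : D ⟶ B) (q : P ⟶ D) (N : VecBundle D 1),
    IsPullback i j a b ∧
    (IsEmpty D ∨ ∃ d, d + 1 = n ∧ SmoothOfRelativeDimension d (i ≫ a ≫ str)) ∧
    IsNormalBundle i N ∧ IsProjectivization N.onePlus q ∧ p = q ≫ i ≫ a
  /-- `F` is the fibre of `π` over a `ℂ`-point `ζ` of `ℙ¹`. -/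
  fibre : ∃ (ζ : SpecC ⟶ P1.left) (w : F ⟶ SpecC),
    ζ ≫ P1.hom = 𝟙 SpecC ∧ IsPullback c w π ζ

section Groups
variable (X : Over SpecC) {s : ℕ} (r : Fin s → ℕ)

/-- The relations `[M] = [N]` for isomorphic `M`, `N`, and `[M] = [N₁] + [N₂]` for a disjoint union
`M` of `N₁` and `N₂`. -/
def monoidRelations : AddSubgroup (FreeAbelianGroup (Cycle X r)) :=
  AddSubgroup.closure
    ({x | ∃ M N : Cycle X r, M.IsIsomorphic N ∧
        x = FreeAbelianGroup.of M - FreeAbelianGroup.of N} ∪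
     {x | ∃ M N₁ N₂ : Cycle X r, M.IsDisjointUnion N₁ N₂ ∧
        x = FreeAbelianGroup.of M - (FreeAbelianGroup.of N₁ + FreeAbelianGroup.of N₂)})

/-- The group completion `ℳ_{*,r}(X)⁺` of the monoid of isomorphism classes (graded by dimension)
under disjoint union, presented by generators and relations: the group completion of a commutative
monoid is the free abelian group on its elements modulo the relations `[m + n] = [m] + [n]`. -/
abbrev MPlus : Type 1 := FreeAbelianGroup (Cycle X r) ⧸ monoidRelations X r

variable {X r} in
/-- The class of an object in the group completion. -/
def MPlus.of (M : Cycle X r) : MPlus X r :=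
  QuotientAddGroup.mk (FreeAbelianGroup.of M)

variable {X r} in
/-- `[F] - [A] - [B] + [P]` is a double point relation over `X`: there are a smooth quasi-projective
`V` of pure dimension `n + 1` with bundles and a projective morphism `g : V → X × ℙ¹`, such that
`π = pr₂ ∘ g` is a double point degeneration over `0` with `π⁻¹(0) = A ∪ B`, `P = ℙ(π)`, and
`F = π⁻¹(ζ)` for a regular value `ζ`, i.e. `F` is smooth of dimension `n`; the morphisms to `X` and
the bundles of `F`, `A`, `B`, `P` are induced by those of `V`. -/
def IsDoublePointRelation (F A B P : Cycle X r) : Prop :=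
  ∃ (n : ℕ) (V : Cycle (timesP1 X) r)
    (a : A.Y ⟶ V.Y) (b : B.Y ⟶ V.Y) (p : P.Y ⟶ V.Y) (c : F.Y ⟶ V.Y),
    V.dim = n + 1 ∧ F.dim = n ∧ A.dim = n ∧ B.dim = n ∧ P.dim = n ∧
    F.IsRestriction V c ∧ A.IsRestriction V a ∧ B.IsRestriction V b ∧ P.IsRestriction V p ∧
    DoublePointGeometry n V.str (V.f ≫ prP1 X) a b p c

/-- The subgroup generated by all double point relations over `X`. -/
def doublePointRelations : AddSubgroup (MPlus X r) :=
  AddSubgroup.closure {x | ∃ F A B P : Cycle X r, IsDoublePointRelation F A B P ∧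
    x = MPlus.of F - MPlus.of A - MPlus.of B + MPlus.of P}

/-- The double point cobordism group `ω_{*,(r_i)}(X)` of lists of vector bundles. In particular
`Omega X ![r]` is `ω_{*,r}(X)`, and `Omega pt ![]` is `ω_*(ℂ)`. -/
abbrev Omega : Type 1 := MPlus X r ⧸ doublePointRelations X r

variable {X r} in
/-- The class `[f : Y → X, (E_i)_i]` in `ω_{*,(r_i)}(X)`. -/
def Omega.of (M : Cycle X r) : Omega X r := QuotientAddGroup.mk (MPlus.of M)

end Groups

section Products

theorem isAffineOpen_prod {S Y Z W : Scheme.{0}} [IsAffine S] {p₁ : W ⟶ Y} {p₂ : W ⟶ Z}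
    {a : Y ⟶ S} {b : Z ⟶ S} (h : IsPullback p₁ p₂ a b) {U : Y.Opens} {V : Z.Opens}
    (hU : IsAffineOpen U) (hV : IsAffineOpen V) : IsAffineOpen (p₁ ⁻¹ᵁ U ⊓ p₂ ⁻¹ᵁ V) := by
  have h1 : IsPullback (p₂ ⁻¹ᵁ V).ι (p₂ ∣_ V) p₂ V.ι := (isPullback_morphismRestrict p₂ V).flip
  have h2 := h1.flip.paste_vert h.flip
  have : IsAffine V.toScheme := hV
  have : IsAffineHom ((p₂ ⁻¹ᵁ V).ι ≫ p₁) :=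
    MorphismProperty.of_isPullback (P := @IsAffineHom) h2 inferInstance
  have h3 := hU.preimage ((p₂ ⁻¹ᵁ V).ι ≫ p₁)
  have h4 := h3.image_of_isOpenImmersion (p₂ ⁻¹ᵁ V).ι
  convert h4 using 1
  rw [Scheme.Hom.comp_preimage, Scheme.Hom.image_preimage_eq_opensRange_inf,
    Scheme.Opens.opensRange_ι, inf_comm]

theorem val_mul_one {R : Type*} [CommRing R] (g h : GL (Fin 1) R) :
    (g * h).val 0 0 = g.val 0 0 * h.val 0 0 := by
  simp [Matrix.mul_apply]

theorem gl_one_comm {R : Type*} [CommRing R] (g h : GL (Fin 1) R) : g * h = h * g := by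
  ext i j
  fin_cases i; fin_cases j
  change (g * h).val 0 0 = (h * g).val 0 0
  rw [val_mul_one, val_mul_one, mul_comm]

/-- The tensor product of line bundles. -/
noncomputable abbrev tensor {Y : Scheme.{0}} (L M : VecBundle Y 1) : VecBundle Y 1 where
  I := L.I × M.I
  U i := L.U i.1 ⊓ M.U i.2
  covers w := by
    obtain ⟨i, hi⟩ := L.covers w
    obtain ⟨j, hj⟩ := M.covers w
    exact ⟨(i, j), hi, hj⟩
  g i j := resGL (inf_le_inf inf_le_left inf_le_left) (L.g i.1 j.1) *
    resGL (inf_le_inf inf_le_right inf_le_right) (M.g i.2 j.2)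
  cocycle i j k := by
    have h1 := congrArg (resGL (V := (L.U i.1 ⊓ M.U i.2) ⊓ (L.U j.1 ⊓ M.U j.2) ⊓
      (L.U k.1 ⊓ M.U k.2)) (inf_le_inf (inf_le_inf inf_le_left inf_le_left) inf_le_left))
      (L.cocycle i.1 j.1 k.1)
    have h2 := congrArg (resGL (V := (L.U i.1 ⊓ M.U i.2) ⊓ (L.U j.1 ⊓ M.U j.2) ⊓
      (L.U k.1 ⊓ M.U k.2)) (inf_le_inf (inf_le_inf inf_le_right inf_le_right) inf_le_right))
      (M.cocycle i.2 j.2 k.2)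
    simp only [map_mul, resGL_resGL] at h1 h2 ⊢
    rw [h1, h2, mul_assoc, mul_assoc, ← mul_assoc (resGL _ (L.g j.1 k.1)),
      gl_one_comm (resGL _ (L.g j.1 k.1)), mul_assoc]

theorem tensor_u {Y : Scheme.{0}} (L M : VecBundle Y 1) (i j : L.I × M.I) :
    (tensor L M).u i j = res (inf_le_inf inf_le_left inf_le_left) (L.u i.1 j.1) *
      res (inf_le_inf inf_le_right inf_le_right) (M.u i.2 j.2) :=
  val_mul_one _ _

/-- The tensor product `σ^{⊗ l} ⊗ τ^{⊗ k}` of powers of sections of `L^{⊗ k}` and `M^{⊗ l}`. -/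
noncomputable def PowSection.tensor {Y : Scheme.{0}} {L M : VecBundle Y 1} {k l : ℕ}
    {O O' : Y.Opens} (σ : PowSection L k O) (τ : PowSection M l O') :
    PowSection (tensor L M) (k * l) (O ⊓ O') where
  s i := res (inf_le_inf inf_le_left inf_le_left) (σ.s i.1) ^ l *
    res (inf_le_inf inf_le_right inf_le_right) (τ.s i.2) ^ k
  compat i j := by
    have h1 := congrArg (res (V := (L.U i.1 ⊓ M.U i.2) ⊓ (L.U j.1 ⊓ M.U j.2) ⊓ (O ⊓ O'))
      (inf_le_inf (inf_le_inf inf_le_left inf_le_left) inf_le_left)) (σ.compat i.1 j.1)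
    have h2 := congrArg (res (V := (L.U i.1 ⊓ M.U i.2) ⊓ (L.U j.1 ⊓ M.U j.2) ⊓ (O ⊓ O'))
      (inf_le_inf (inf_le_inf inf_le_right inf_le_right) inf_le_right)) (τ.compat i.2 j.2)
    rw [tensor_u]
    simp only [map_mul, map_pow, res_res] at h1 h2 ⊢
    rw [h1, h2]
    ring

theorem basicOpen_res_pow {Y : Scheme.{0}} {V U : Y.Opens} (h : V ≤ U) (a : Γ(Y, U)) {k : ℕ}
    (hk : 0 < k) : Y.basicOpen (res h a ^ k) = V ⊓ Y.basicOpen a := by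
  rw [Scheme.basicOpen_pow _ _ hk]
  exact Scheme.basicOpen_res _ _ _

theorem PowSection.tensor_nonvanishing {Y : Scheme.{0}} {L M : VecBundle Y 1} {k l : ℕ}
    (hk : 0 < k) (hl : 0 < l) {O O' : Y.Opens} (σ : PowSection L k O) (τ : PowSection M l O') :
    (σ.tensor τ).nonvanishing = σ.nonvanishing ⊓ τ.nonvanishing := by
  have key : ∀ i : L.I × M.I, Y.basicOpen ((σ.tensor τ).s i) =
      Y.basicOpen (σ.s i.1) ⊓ Y.basicOpen (τ.s i.2) := by
    intro i
    simp only [PowSection.tensor]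
    rw [Scheme.basicOpen_mul, basicOpen_res_pow _ _ hl, basicOpen_res_pow _ _ hk]
    have h1 := Y.basicOpen_le (σ.s i.1)
    have h2 := Y.basicOpen_le (τ.s i.2)
    apply le_antisymm
    · exact inf_le_inf inf_le_right inf_le_right
    · refine le_inf (le_inf ?_ inf_le_left) (le_inf ?_ inf_le_right) <;>
      exact (inf_le_inf h1 h2).trans (le_inf (inf_le_inf inf_le_left inf_le_left)
        (inf_le_inf inf_le_right inf_le_right))
  simp only [nonvanishing]
  rw [iSup_inf_iSup]
  exact iSup_congr key

/-- The pullback of a section. -/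
noncomputable def PowSection.pullback {T Y : Scheme.{0}} (f : T ⟶ Y) {L : VecBundle Y 1} {k : ℕ}
    {O : Y.Opens} (σ : PowSection L k O) : PowSection (L.pullback f) k (f ⁻¹ᵁ O) where
  s i := pull f _ (σ.s i)
  compat i j := by
    have := congrArg (pull f _) (σ.compat i j)
    simp only [map_mul, map_pow, res_pull] at this
    exact this

theorem PowSection.pullback_nonvanishing {T Y : Scheme.{0}} (f : T ⟶ Y) {L : VecBundle Y 1}
    {k : ℕ} {O : Y.Opens} (σ : PowSection L k O) :
    (σ.pullback f).nonvanishing = f ⁻¹ᵁ σ.nonvanishing := by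
  simp only [nonvanishing, PowSection.pullback]
  rw [Scheme.Hom.preimage_iSup]
  congr 1; funext i
  exact (Scheme.preimage_basicOpen f _).symm

theorem RelativelyAmple.prod {S X X' T Y Z W : Scheme.{0}} [IsAffine S] {x : X ⟶ S} {x' : X' ⟶ S}
    {q₁ : T ⟶ X} {q₂ : T ⟶ X'} {f : Y ⟶ X} {g : Z ⟶ X'} {p₁ : W ⟶ Y} {p₂ : W ⟶ Z} {h : W ⟶ T}
    (hT : IsPullback q₁ q₂ x x') (hW : IsPullback p₁ p₂ (f ≫ x) (g ≫ x'))
    (h₁ : h ≫ q₁ = p₁ ≫ f) (h₂ : h ≫ q₂ = p₂ ≫ g) {L : VecBundle Y 1} {M : VecBundle Z 1}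
    (hL : RelativelyAmple f L) (hM : RelativelyAmple g M) :
    RelativelyAmple h (tensor (L.pullback p₁) (M.pullback p₂)) := by
  intro t
  obtain ⟨V₁, ht₁, hV₁, H₁⟩ := hL (q₁ t)
  obtain ⟨V₂, ht₂, hV₂, H₂⟩ := hM (q₂ t)
  refine ⟨q₁ ⁻¹ᵁ V₁ ⊓ q₂ ⁻¹ᵁ V₂, ⟨ht₁, ht₂⟩, isAffineOpen_prod hT hV₁ hV₂, ?_⟩
  have e₁ : h ⁻¹ᵁ q₁ ⁻¹ᵁ V₁ = p₁ ⁻¹ᵁ f ⁻¹ᵁ V₁ := by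
    rw [← Scheme.Hom.comp_preimage, h₁, Scheme.Hom.comp_preimage]
  have e₂ : h ⁻¹ᵁ q₂ ⁻¹ᵁ V₂ = p₂ ⁻¹ᵁ g ⁻¹ᵁ V₂ := by
    rw [← Scheme.Hom.comp_preimage, h₂, Scheme.Hom.comp_preimage]
  rw [Scheme.Hom.preimage_inf, e₁, e₂]
  intro w hw
  obtain ⟨k, hk, σ, hσ, aσ⟩ := H₁ (p₁ w) hw.1
  obtain ⟨l, hl, τ, hτ, aτ⟩ := H₂ (p₂ w) hw.2
  refine ⟨k * l, Nat.mul_pos hk hl, (σ.pullback p₁).tensor (τ.pullback p₂), ?_⟩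
  rw [PowSection.tensor_nonvanishing hk hl, PowSection.pullback_nonvanishing,
    PowSection.pullback_nonvanishing]
  exact ⟨⟨hσ, hτ⟩, isAffineOpen_prod hW aσ aτ⟩

theorem isProper_prod {S X X' T Y Z W : Scheme.{0}} {x : X ⟶ S} {x' : X' ⟶ S}
    {q₁ : T ⟶ X} {q₂ : T ⟶ X'} {f : Y ⟶ X} {g : Z ⟶ X'} {p₁ : W ⟶ Y} {p₂ : W ⟶ Z} {h : W ⟶ T}
    (hT : IsPullback q₁ q₂ x x') (hW : IsPullback p₁ p₂ (f ≫ x) (g ≫ x'))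
    (h₁ : h ≫ q₁ = p₁ ≫ f) (h₂ : h ≫ q₂ = p₂ ≫ g) [IsProper f] [IsProper g] : IsProper h := by
  have e : IsPullback (Limits.pullback.fst q₁ f) (Limits.pullback.snd q₁ f) q₁ f := .of_hasPullback _ _
  have hk := e.flip.paste_vert hT
  have h1 : IsProper (Limits.pullback.fst q₁ f) := MorphismProperty.of_isPullback (P := @IsProper) e.flip inferInstance
  let l : W ⟶ Limits.pullback q₁ f := Limits.pullback.lift h p₁ h₁
  have hl : IsPullback p₂ l g (Limits.pullback.fst q₁ f ≫ q₂) := by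
    refine (IsPullback.of_right (t := hk) ?_ ?_).flip
    · have : l ≫ Limits.pullback.snd q₁ f = p₁ := Limits.pullback.lift_snd _ _ _
      rw [this]; exact hW
    · have : l ≫ Limits.pullback.fst q₁ f = h := Limits.pullback.lift_fst _ _ _
      rw [← Category.assoc, this, h₂]
  have h2 : IsProper l := MorphismProperty.of_isPullback (P := @IsProper) hl inferInstance
  have : h = l ≫ Limits.pullback.fst q₁ f := (Limits.pullback.lift_fst _ _ _).symm
  rw [this]; infer_instance

theorem IsProjective.prod {S X X' T Y Z W : Scheme.{0}} [IsAffine S] {x : X ⟶ S} {x' : X' ⟶ S}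
    {q₁ : T ⟶ X} {q₂ : T ⟶ X'} {f : Y ⟶ X} {g : Z ⟶ X'} {p₁ : W ⟶ Y} {p₂ : W ⟶ Z} {h : W ⟶ T}
    (hT : IsPullback q₁ q₂ x x') (hW : IsPullback p₁ p₂ (f ≫ x) (g ≫ x'))
    (h₁ : h ≫ q₁ = p₁ ≫ f) (h₂ : h ≫ q₂ = p₂ ≫ g) (hf : IsProjective f) (hg : IsProjective g) :
    IsProjective h := by
  obtain ⟨_, L, hL⟩ := hf
  obtain ⟨_, M, hM⟩ := hg
  exact ⟨isProper_prod hT hW h₁ h₂, _, hL.prod hT hW h₁ h₂ hM⟩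

theorem IsQuasiProjective.prod {S Y Z W : Scheme.{0}} [IsAffine S]
    {f : Y ⟶ S} {g : Z ⟶ S} {p₁ : W ⟶ Y} {p₂ : W ⟶ Z} {h : W ⟶ S}
    (hW : IsPullback p₁ p₂ f g) (hh : h = p₁ ≫ f)
    (hf : IsQuasiProjective f) (hg : IsQuasiProjective g) : IsQuasiProjective h := by
  obtain ⟨_, _, L, hL⟩ := hf
  obtain ⟨_, _, M, hM⟩ := hg
  subst hh
  have a1 : LocallyOfFiniteType p₁ :=
    MorphismProperty.of_isPullback (P := @LocallyOfFiniteType) hW.flip inferInstance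
  have a2 : QuasiCompact p₁ :=
    MorphismProperty.of_isPullback (P := @QuasiCompact) hW.flip inferInstance
  refine ⟨inferInstance, inferInstance, _, hL.prod (x := 𝟙 S) (x' := 𝟙 S) (q₁ := 𝟙 S) (q₂ := 𝟙 S)
    (IsPullback.of_vert_isIso ⟨rfl⟩) (by simpa using hW) (by simp) (by simp [hW.w]) hM⟩

theorem smooth_prod {S Y Z W : Scheme.{0}} {n m : ℕ}
    {f : Y ⟶ S} {g : Z ⟶ S} {p₁ : W ⟶ Y} {p₂ : W ⟶ Z} {h : W ⟶ S}
    (hW : IsPullback p₁ p₂ f g) (hh : h = p₂ ≫ g)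
    (hf : SmoothOfRelativeDimension n f) (hg : SmoothOfRelativeDimension m g) :
    SmoothOfRelativeDimension (n + m) h := by
  subst hh
  have := smoothOfRelativeDimension_isStableUnderBaseChange n
  have a1 : SmoothOfRelativeDimension n p₂ :=
    MorphismProperty.of_isPullback (P := @SmoothOfRelativeDimension n) hW hf
  exact smoothOfRelativeDimension_comp n m p₂ g

namespace Cycle
variable {X : Over SpecC} {s : ℕ} {r : Fin s → ℕ}

/-- The exterior product `[Z] · [f : Y → X, E] = [Z × Y → X, pr₂^* E]`. -/
noncomputable abbrev prod (Z : Cycle pt ![]) (M : Cycle X r) : Cycle X r where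
  dim := Z.dim + M.dim
  Y := Limits.pullback Z.str M.str
  f := Limits.pullback.snd Z.str M.str ≫ M.f
  smooth := smooth_prod (.of_hasPullback Z.str M.str) (Category.assoc _ _ _) Z.smooth M.smooth
  quasiProjective := .prod (.of_hasPullback Z.str M.str)
    (by rw [Category.assoc]; exact Limits.pullback.condition.symm)
    Z.quasiProjective M.quasiProjective
  projective := .prod (q₁ := X.hom) (q₂ := 𝟙 X.left) (x := pt.hom) (x' := X.hom)
    (by
      have : IsIso pt.hom := inferInstanceAs (IsIso (𝟙 SpecC))
      exact IsPullback.of_vert_isIso ⟨by rw [Category.id_comp]; exact Category.comp_id _⟩)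
    (.of_hasPullback Z.str M.str)
    (by
      have := Limits.pullback.condition (f := Z.str) (g := M.str)
      have h : Z.str = Z.f := Category.comp_id _
      rw [Category.assoc, ← this, h])
    (Category.comp_id _) Z.projective M.projective
  E i := (M.E i).pullback (Limits.pullback.snd Z.str M.str)
end Cycle

section BaseChange

theorem CutsOut.baseChange {A' A V' V : Scheme.{0}} {a' : A' ⟶ V'} {pA : A' ⟶ A} {p : V' ⟶ V}
    {a : A ⟶ V} (h : IsPullback a' pA p a) {W : V.Opens} {e : Γ(V, W)} (hc : CutsOut a W e) :
    CutsOut a' (p ⁻¹ᵁ W) (pull p W e) := by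
  intro T t ht
  refine Iff.trans ?_ (hc T (t ≫ p) ht)
  constructor
  · rintro ⟨l, rfl⟩
    exact ⟨l ≫ pA, by rw [Category.assoc, Category.assoc, h.w]⟩
  · rintro ⟨l, hl⟩
    exact ⟨h.lift t l hl.symm, h.lift_fst _ _ _⟩

theorem IsNormalBundle.baseChange {D' D A' A : Scheme.{0}} {i' : D' ⟶ A'} {pD : D' ⟶ D}
    {p : A' ⟶ A} {i : D ⟶ A} (h : IsPullback i' pD p i) {N : VecBundle D 1}
    (hN : IsNormalBundle i N) : IsNormalBundle i' (N.pullback pD) := by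
  obtain ⟨L, e, h1, h2, h3⟩ := hN
  refine ⟨L.pullback p, fun k => pull p _ (e k), fun k => (h1 k).baseChange h, fun k l => ?_, ?_⟩
  · have := congrArg (pull p _) (h2 k l)
    simp only [map_mul, res_pull] at this
    exact this
  · have := h3.pullback pD
    rw [← VecBundle.pullback_comp, ← h.w] at this
    exact this

theorem VecBundle.onePlus_pullback {T Y : Scheme.{0}} (f : T ⟶ Y) (N : VecBundle Y 1) :
    (N.pullback f).onePlus = N.onePlus.pullback f := by
  unfold VecBundle.onePlus VecBundle.pullback
  congr 1
  funext i j
  exact (map_oneBlock _ _).symm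

/-- The pullback of a line subbundle. -/
noncomputable def LineSubbundle.comp {D T T' : Scheme.{0}} {r : ℕ} {E : VecBundle D r} {t : T ⟶ D}
    (σ : LineSubbundle E t) (v : T' ⟶ T) : LineSubbundle E (v ≫ t) where
  J := σ.J
  V a := v ⁻¹ᵁ σ.V a
  covers y := σ.covers (v y)
  m i a k := pull v _ (σ.m i a k)
  compat i j a k := by
    have := congrArg (pull v _) (σ.compat i j a k)
    simp only [map_sum, map_mul, res_pull] at this
    exact this
  nowhere_zero i a := by
    have := v.preimage_mono (σ.nowhere_zero i a)
    rw [Scheme.Hom.preimage_iSup] at this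
    simp only [Scheme.preimage_basicOpen] at this
    exact this
  proportional i a b := by
    obtain ⟨c, hc⟩ := σ.proportional i a b
    refine ⟨Units.map (pull v _).toMonoidHom c, fun k => ?_⟩
    have := congrArg (pull v _) (hc k)
    simp only [map_mul, res_pull] at this
    exact this

/-- A line subbundle of `t'^* (p^* E)` is a line subbundle of `(t' ≫ p)^* E`. -/
def LineSubbundle.ofPullback {D' D T : Scheme.{0}} {r : ℕ} {E : VecBundle D r} {p : D' ⟶ D}
    {t : T ⟶ D'} (σ : LineSubbundle (E.pullback p) t) : LineSubbundle E (t ≫ p) where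
  J := σ.J
  V := σ.V
  covers := σ.covers
  m := σ.m
  compat := σ.compat
  nowhere_zero := σ.nowhere_zero
  proportional := σ.proportional

/-- The converse of `LineSubbundle.ofPullback`. -/
def LineSubbundle.toPullback {D' D T : Scheme.{0}} {r : ℕ} {E : VecBundle D r} {p : D' ⟶ D}
    {t : T ⟶ D'} (σ : LineSubbundle E (t ≫ p)) : LineSubbundle (E.pullback p) t where
  J := σ.J
  V := σ.V
  covers := σ.covers
  m := σ.m
  compat := σ.compat
  nowhere_zero := σ.nowhere_zero
  proportional := σ.proportional

theorem LineSubbundle.cast_isPullbackAlong {D P P' T : Scheme.{0}} {r : ℕ} {E : VecBundle D r}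
    {q : P ⟶ D} (τ : LineSubbundle E q) (v : P' ⟶ P) {s : P' ⟶ D} (h : v ≫ q = s) (u : T ⟶ P')
    {t : T ⟶ D} (σ : LineSubbundle E t) :
    LineSubbundle.IsPullbackAlong (h ▸ τ.comp v : LineSubbundle E s) u σ ↔
      τ.IsPullbackAlong (u ≫ v) σ := by
  subst h; rfl

theorem IsProjectivization.baseChange {P' P D' D : Scheme.{0}} {r : ℕ} {E : VecBundle D r}
    {q' : P' ⟶ D'} {pP : P' ⟶ P} {p : D' ⟶ D} {q : P ⟶ D} (h : IsPullback q' pP p q)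
    (hE : IsProjectivization E q) : IsProjectivization (E.pullback p) q' := by
  obtain ⟨τ, hτ⟩ := hE
  let τ₀ : LineSubbundle E (q' ≫ p) := h.w.symm ▸ τ.comp pP
  refine ⟨τ₀.toPullback, fun T t σ => ?_⟩
  have key : ∀ u : T ⟶ P', τ₀.toPullback.IsPullbackAlong u σ ↔
      τ.IsPullbackAlong (u ≫ pP) σ.ofPullback := fun u =>
    LineSubbundle.cast_isPullbackAlong τ pP h.w.symm u σ.ofPullback
  obtain ⟨u, ⟨hu, hu'⟩, huniq⟩ := hτ T (t ≫ p) σ.ofPullback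
  refine ⟨h.lift t u hu.symm, ⟨h.lift_fst _ _ _, (key _).2 ?_⟩, ?_⟩
  · rw [h.lift_snd]; exact hu'
  · rintro v ⟨hv, hv'⟩
    have := huniq (v ≫ pP) ⟨by rw [Category.assoc, ← h.w, ← Category.assoc, hv], (key v).1 hv'⟩
    apply h.hom_ext
    · rw [hv, h.lift_fst]
    · rw [this, h.lift_snd]

theorem DoublePointGeometry.baseChange {V A B P F V' A' B' P' F' : Scheme.{0}} {n m : ℕ}
    {str : V ⟶ SpecC} {π : V ⟶ P1.left} {a : A ⟶ V} {b : B ⟶ V} {p : P ⟶ V} {c : F ⟶ V}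
    (H : DoublePointGeometry n str π a b p c)
    {v : V' ⟶ V} (hv : SmoothOfRelativeDimension m v)
    {a' : A' ⟶ V'} {b' : B' ⟶ V'} {p' : P' ⟶ V'} {c' : F' ⟶ V'} {vA : A' ⟶ A} {vB : B' ⟶ B}
    {vP : P' ⟶ P} {vF : F' ⟶ F} (ha : IsPullback a' vA v a) (hb : IsPullback b' vB v b)
    (hp : IsPullback p' vP v p) (hc : IsPullback c' vF v c) :
    DoublePointGeometry (m + n) (v ≫ str) (v ≫ π) a' b' p' c' := by
  have := H.closed_a
  have := H.closed_b
  refine ⟨MorphismProperty.of_isPullback (P := @IsClosedImmersion) ha.flip inferInstance,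
    MorphismProperty.of_isPullback (P := @IsClosedImmersion) hb.flip inferInstance, ?_, ?_, ?_⟩
  · obtain ⟨z, Z, i, w, hz, hi, hu⟩ := H.union
    have sq : IsPullback (Limits.pullback.fst v i) (Limits.pullback.snd v i) v i :=
      .of_hasPullback _ _
    refine ⟨z, _, Limits.pullback.fst v i, Limits.pullback.snd v i ≫ w, hz, ?_, fun y => ?_⟩
    · exact (sq.flip.paste_horiz hi.flip).flip
    · obtain ⟨W, α, β, hy, h1, h2, h3⟩ := hu (v y)
      refine ⟨v ⁻¹ᵁ W, pull v W α, pull v W β, hy, h1.baseChange ha, h2.baseChange hb, ?_⟩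
      rw [← map_mul]
      exact h3.baseChange sq
  · obtain ⟨D, i, j, q, N, hD, hdim, hN, hP, rfl⟩ := H.bundle
    have sqi : IsPullback (Limits.pullback.fst vA i) (Limits.pullback.snd vA i) vA i :=
      .of_hasPullback _ _
    have sqV : IsPullback (Limits.pullback.fst vA i ≫ a') (Limits.pullback.snd vA i) v (i ≫ a) :=
      sqi.paste_horiz ha
    have e : (Limits.pullback.fst vA i ≫ a') ≫ v = (Limits.pullback.snd vA i ≫ j) ≫ b := by
      rw [sqV.w, Category.assoc, hD.w]
    let j' := hb.lift _ _ e
    have hj1 : j' ≫ b' = Limits.pullback.fst vA i ≫ a' := hb.lift_fst _ _ _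
    have hj2 : j' ≫ vB = Limits.pullback.snd vA i ≫ j := hb.lift_snd _ _ _
    have e2 : p' ≫ v = (vP ≫ q) ≫ i ≫ a := by rw [hp.w, Category.assoc]
    let q' := sqV.lift _ _ e2
    have hq1 : q' ≫ Limits.pullback.fst vA i ≫ a' = p' := sqV.lift_fst _ _ _
    have hq2 : q' ≫ Limits.pullback.snd vA i = vP ≫ q := sqV.lift_snd _ _ _
    refine ⟨_, Limits.pullback.fst vA i, j', q', N.pullback (Limits.pullback.snd vA i), ?_, ?_,
      hN.baseChange sqi, ?_, hq1.symm⟩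
    · refine (IsPullback.of_right (t := hb.flip) ?_ hj1).flip
      rw [hj2, ha.w]
      exact sqi.flip.paste_horiz hD.flip
    · refine hdim.imp (fun hD0 => ?_) ?_
      · have : IsEmpty D := hD0
        exact Function.isEmpty (Limits.pullback.snd vA i)
      · rintro ⟨d, hd, hs⟩
        refine ⟨m + d, by omega, ?_⟩
        have := smoothOfRelativeDimension_isStableUnderBaseChange m
        have h1 : SmoothOfRelativeDimension m (Limits.pullback.snd vA i) :=
          MorphismProperty.of_isPullback (P := @SmoothOfRelativeDimension m) sqV hv
        have h2 : Limits.pullback.fst vA i ≫ a' ≫ v ≫ str =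
            Limits.pullback.snd vA i ≫ i ≫ a ≫ str := by
          have := sqV.w =≫ str
          simpa using this
        rw [h2]
        exact smoothOfRelativeDimension_comp m d _ _
    · rw [VecBundle.onePlus_pullback]
      refine hP.baseChange (pP := vP) ?_
      refine IsPullback.of_right (t := sqV) ?_ hq2
      rw [hq1]; exact hp
  · obtain ⟨ζ, w, hζ, hF⟩ := H.fibre
    exact ⟨ζ, vF ≫ w, hζ, (hc.flip.paste_horiz hF.flip).flip⟩

end BaseChange

namespace Omega
variable {X : Over SpecC} {s : ℕ} {r : Fin s → ℕ}

/-- Homomorphisms out of the group completion. -/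
def liftMPlus {G : Type*} [AddCommGroup G] (φ : Cycle X r → G)
    (h₁ : ∀ M N : Cycle X r, M.IsIsomorphic N → φ M = φ N)
    (h₂ : ∀ M N₁ N₂ : Cycle X r, M.IsDisjointUnion N₁ N₂ → φ M = φ N₁ + φ N₂) :
    MPlus X r →+ G :=
  QuotientAddGroup.lift (monoidRelations X r) (FreeAbelianGroup.lift φ)
    ((AddSubgroup.closure_le _).2 (by
      rintro x (⟨M, N, h, rfl⟩ | ⟨M, N₁, N₂, h, rfl⟩)
      · simp [AddMonoidHom.mem_ker, h₁ M N h]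
      · simp [AddMonoidHom.mem_ker, h₂ M N₁ N₂ h]))

theorem liftMPlus_of {G : Type*} [AddCommGroup G] (φ : Cycle X r → G) (h₁) (h₂)
    (M : Cycle X r) : liftMPlus φ h₁ h₂ (MPlus.of M) = φ M :=
  FreeAbelianGroup.lift_apply_of _ _

/-- Homomorphisms out of the cobordism group. -/
def lift {G : Type*} [AddCommGroup G] (φ : Cycle X r → G)
    (h₁ : ∀ M N : Cycle X r, M.IsIsomorphic N → φ M = φ N)
    (h₂ : ∀ M N₁ N₂ : Cycle X r, M.IsDisjointUnion N₁ N₂ → φ M = φ N₁ + φ N₂)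
    (h₃ : ∀ F A B P : Cycle X r, IsDoublePointRelation F A B P →
      φ F - φ A - φ B + φ P = 0) :
    Omega X r →+ G :=
  QuotientAddGroup.lift (doublePointRelations X r) (liftMPlus φ h₁ h₂)
    ((AddSubgroup.closure_le _).2 (by
      rintro x ⟨F, A, B, P, h, rfl⟩
      rw [SetLike.mem_coe, AddMonoidHom.mem_ker, map_add, map_sub, map_sub]
      simp only [liftMPlus_of]
      exact h₃ F A B P h))

@[simp] theorem lift_of {G : Type*} [AddCommGroup G] (φ : Cycle X r → G) (h₁) (h₂) (h₃)
    (M : Cycle X r) : lift φ h₁ h₂ h₃ (of M) = φ M :=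
  FreeAbelianGroup.lift_apply_of _ _

theorem hom_ext {G : Type*} [AddCommGroup G] {f g : Omega X r →+ G}
    (h : ∀ M, f (of M) = g (of M)) : f = g := by
  apply QuotientAddGroup.addMonoidHom_ext
  apply QuotientAddGroup.addMonoidHom_ext
  apply FreeAbelianGroup.lift_ext
  exact h

theorem of_eq_of_iso {M N : Cycle X r} (h : M.IsIsomorphic N) : of M = of N := by
  have : (MPlus.of M : MPlus X r) = MPlus.of N := by
    rw [← sub_eq_zero]
    exact (QuotientAddGroup.eq_zero_iff _).2 (AddSubgroup.subset_closure (Or.inl ⟨M, N, h, rfl⟩))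
  rw [of, this]; rfl

theorem of_disjointUnion {M N₁ N₂ : Cycle X r} (h : M.IsDisjointUnion N₁ N₂) :
    of M = of N₁ + of N₂ := by
  have : (MPlus.of M : MPlus X r) = MPlus.of N₁ + MPlus.of N₂ := by
    rw [← sub_eq_zero]
    exact (QuotientAddGroup.eq_zero_iff _).2
      (AddSubgroup.subset_closure (Or.inr ⟨M, N₁, N₂, h, rfl⟩))
  rw [of, this]; rfl

theorem of_doublePoint {F A B P : Cycle X r} (h : IsDoublePointRelation F A B P) :
    of F - of A - of B + of P = 0 :=
  (QuotientAddGroup.eq_zero_iff _).2 (AddSubgroup.subset_closure ⟨F, A, B, P, h, rfl⟩)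

end Omega

namespace Cycle
variable {X : Over SpecC} {s : ℕ} {r : Fin s → ℕ}

theorem prod_str (Z : Cycle pt ![]) (M : Cycle X r) :
    (Z.prod M).str = Limits.pullback.snd Z.str M.str ≫ M.str := Category.assoc _ _ _

theorem isIsomorphic_prod {W : Cycle X r} {Z : Cycle pt ![]} {M : Cycle X r} {p₁ : W.Y ⟶ Z.Y}
    {p₂ : W.Y ⟶ M.Y} (h : IsPullback p₁ p₂ Z.str M.str) (hf : W.f = p₂ ≫ M.f)
    (hE : ∀ i, (W.E i).IsIsomorphic ((M.E i).pullback p₂)) : W.IsIsomorphic (Z.prod M) := by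
  refine ⟨h.isoPullback, ?_, fun i => ?_⟩
  · change _ ≫ _ ≫ _ = _
    rw [hf, ← Category.assoc, h.isoPullback_hom_snd]
  · change (W.E i).IsIsomorphic ((M.E i).pullback (h.isoPullback.hom ≫ Limits.pullback.snd _ _))
    rw [h.isoPullback_hom_snd]; exact hE i

theorem IsIsomorphic.prod_left {Z Z' : Cycle pt ![]} (h : Z.IsIsomorphic Z') (M : Cycle X r) :
    (Z.prod M).IsIsomorphic (Z'.prod M) := by
  obtain ⟨φ, hφ, -⟩ := h
  refine isIsomorphic_prod (p₁ := Limits.pullback.fst Z.str M.str ≫ φ.hom)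
    (p₂ := Limits.pullback.snd Z.str M.str) ?_ rfl fun i => .refl _
  refine IsPullback.of_iso (.of_hasPullback Z.str M.str) (Iso.refl _) φ (Iso.refl _) (Iso.refl _)
    (by simp) (by simp) ?_ (by simp)
  rw [Iso.refl_hom, Category.comp_id, ← Category.assoc, hφ]

theorem IsIsomorphic.prod_right (Z : Cycle pt ![]) {M M' : Cycle X r} (h : M.IsIsomorphic M') :
    (Z.prod M).IsIsomorphic (Z.prod M') := by
  obtain ⟨φ, hφ, hE⟩ := h
  refine isIsomorphic_prod (p₁ := Limits.pullback.fst Z.str M.str)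
    (p₂ := Limits.pullback.snd Z.str M.str ≫ φ.hom) ?_ ?_ fun i => ?_
  · refine IsPullback.of_iso (.of_hasPullback Z.str M.str) (Iso.refl _) (Iso.refl _) φ (Iso.refl _)
      (by simp) (by simp) (by simp) ?_
    rw [Iso.refl_hom, Category.comp_id, ← Category.assoc, hφ]
  · rw [Category.assoc, hφ]
  · exact (hE i).pullback _

theorem isCompl_preimage {T Y : Scheme.{0}} (f : T ⟶ Y) {U V : Y.Opens} (h : IsCompl U V) :
    IsCompl (f ⁻¹ᵁ U) (f ⁻¹ᵁ V) := by
  rw [isCompl_iff, disjoint_iff, codisjoint_iff] at h ⊢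
  rw [← Scheme.Hom.preimage_inf, ← Scheme.Hom.preimage_sup, h.1, h.2]
  exact ⟨rfl, rfl⟩

theorem opensRange_of_isPullback {P X Y Z : Scheme.{0}} {k : P ⟶ X} {l : P ⟶ Y} {f : X ⟶ Z}
    {j : Y ⟶ Z} [IsOpenImmersion k] [IsOpenImmersion j] (h : IsPullback k l f j) :
    k.opensRange = f ⁻¹ᵁ j.opensRange := by
  rw [← Scheme.Hom.opensRange_pullbackFst, ← Scheme.Hom.opensRange_comp_of_isIso h.isoPullback.hom]
  congr 1
  exact h.isoPullback_hom_fst.symm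

/-- The common part of the two compatibilities of products with disjoint unions. -/
theorem isDisjointUnion_of_baseChange {M M₁ M₂ : Cycle X r} {W : Scheme.{0}} {W₁ W₂ : Scheme.{0}}
    {v : M.Y ⟶ W} {j₁ : W₁ ⟶ W} {j₂ : W₂ ⟶ W} [IsOpenImmersion j₁] [IsOpenImmersion j₂]
    (hc : IsCompl j₁.opensRange j₂.opensRange) {k₁ : M₁.Y ⟶ M.Y} {k₂ : M₂.Y ⟶ M.Y}
    {v₁ : M₁.Y ⟶ W₁} {v₂ : M₂.Y ⟶ W₂} (s₁ : IsPullback k₁ v₁ v j₁) (s₂ : IsPullback k₂ v₂ v j₂)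
    (f₁ : M₁.f = k₁ ≫ M.f) (f₂ : M₂.f = k₂ ≫ M.f)
    (E₁ : ∀ i, (M₁.E i).IsIsomorphic ((M.E i).pullback k₁))
    (E₂ : ∀ i, (M₂.E i).IsIsomorphic ((M.E i).pullback k₂)) : M.IsDisjointUnion M₁ M₂ := by
  have o₁ : IsOpenImmersion k₁ := MorphismProperty.of_isPullback s₁.flip ‹IsOpenImmersion j₁›
  have o₂ : IsOpenImmersion k₂ := MorphismProperty.of_isPullback s₂.flip ‹IsOpenImmersion j₂›
  refine ⟨k₁, k₂, o₁, o₂, ?_, f₁, f₂, E₁, E₂⟩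
  rw [opensRange_of_isPullback s₁, opensRange_of_isPullback s₂]
  exact isCompl_preimage v hc

/-- Base change of `Z'.prod M → Z.prod M` along `j : Z' → Z`. -/
theorem exists_prod_left {Z' Z : Cycle pt ![]} (j : Z'.Y ⟶ Z.Y) (hs : Z'.str = j ≫ Z.str)
    (M : Cycle X r) : ∃ k : (Z'.prod M).Y ⟶ (Z.prod M).Y,
      k ≫ Limits.pullback.snd Z.str M.str = Limits.pullback.snd Z'.str M.str ∧
      IsPullback k (Limits.pullback.fst Z'.str M.str) (Limits.pullback.fst Z.str M.str) j := by
  refine ⟨Limits.pullback.lift (Limits.pullback.fst _ _ ≫ j) (Limits.pullback.snd _ _) ?_,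
    Limits.pullback.lift_snd _ _ _, ?_⟩
  · rw [Category.assoc, ← hs, Limits.pullback.condition]
  · refine IsPullback.of_right (t := (IsPullback.of_hasPullback Z.str M.str).flip) ?_ ?_
    · rw [Limits.pullback.lift_snd, ← hs]; exact (IsPullback.of_hasPullback _ _).flip
    · exact Limits.pullback.lift_fst _ _ _

/-- Base change of `Z.prod M' → Z.prod M` along `j : M' → M`. -/
theorem exists_prod_right {X' : Over SpecC} {s' : ℕ} {r' : Fin s' → ℕ} (Z : Cycle pt ![])
    {M' : Cycle X r} {M : Cycle X' r'} (j : M'.Y ⟶ M.Y) (hs : M'.str = j ≫ M.str) :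
    ∃ k : (Z.prod M').Y ⟶ (Z.prod M).Y,
      k ≫ Limits.pullback.fst Z.str M.str = Limits.pullback.fst Z.str M'.str ∧
      IsPullback k (Limits.pullback.snd Z.str M'.str) (Limits.pullback.snd Z.str M.str) j := by
  refine ⟨Limits.pullback.lift (Limits.pullback.fst _ _) (Limits.pullback.snd _ _ ≫ j) ?_,
    Limits.pullback.lift_fst _ _ _, ?_⟩
  · rw [Category.assoc, ← hs, Limits.pullback.condition]
  · refine IsPullback.of_right (t := IsPullback.of_hasPullback Z.str M.str) ?_ ?_
    · rw [Limits.pullback.lift_fst, ← hs]; exact IsPullback.of_hasPullback _ _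
    · exact Limits.pullback.lift_snd _ _ _

theorem IsDisjointUnion.prod_left {Z Z₁ Z₂ : Cycle pt ![]} (h : Z.IsDisjointUnion Z₁ Z₂)
    (M : Cycle X r) : (Z.prod M).IsDisjointUnion (Z₁.prod M) (Z₂.prod M) := by
  obtain ⟨j₁, j₂, _, _, hc, h₁, h₂, -, -⟩ := h
  obtain ⟨k₁, e₁, s₁⟩ := exists_prod_left j₁ (by rw [str, h₁, Category.assoc]) M
  obtain ⟨k₂, e₂, s₂⟩ := exists_prod_left j₂ (by rw [str, h₂, Category.assoc]) M
  refine isDisjointUnion_of_baseChange hc s₁ s₂ ?_ ?_ (fun i => ?_) (fun i => ?_)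
  · rw [← Category.assoc, e₁]
  · rw [← Category.assoc, e₂]
  · change VecBundle.IsIsomorphic _ ((M.E i).pullback (_ ≫ _))
    rw [e₁]; exact .refl _
  · change VecBundle.IsIsomorphic _ ((M.E i).pullback (_ ≫ _))
    rw [e₂]; exact .refl _

theorem IsDisjointUnion.prod_right (Z : Cycle pt ![]) {M M₁ M₂ : Cycle X r}
    (h : M.IsDisjointUnion M₁ M₂) : (Z.prod M).IsDisjointUnion (Z.prod M₁) (Z.prod M₂) := by
  obtain ⟨j₁, j₂, _, _, hc, h₁, h₂, hE₁, hE₂⟩ := h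
  obtain ⟨k₁, -, s₁⟩ := exists_prod_right Z j₁ (by rw [str, h₁, Category.assoc])
  obtain ⟨k₂, -, s₂⟩ := exists_prod_right Z j₂ (by rw [str, h₂, Category.assoc])
  refine isDisjointUnion_of_baseChange hc s₁ s₂ ?_ ?_ (fun i => ?_) (fun i => ?_)
  · change Limits.pullback.snd Z.str M₁.str ≫ M₁.f = k₁ ≫ Limits.pullback.snd Z.str M.str ≫ M.f
    rw [← Category.assoc, s₁.w, h₁, Category.assoc]
  · change Limits.pullback.snd Z.str M₂.str ≫ M₂.f = k₂ ≫ Limits.pullback.snd Z.str M.str ≫ M.f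
    rw [← Category.assoc, s₂.w, h₂, Category.assoc]
  · change VecBundle.IsIsomorphic _ ((M.E i).pullback (_ ≫ _))
    rw [s₁.w]; exact (hE₁ i).pullback _
  · change VecBundle.IsIsomorphic _ ((M.E i).pullback (_ ≫ _))
    rw [s₂.w]; exact (hE₂ i).pullback _

theorem IsRestriction.str_eq {N : Cycle X r} {V : Cycle (timesP1 X) r} {k : N.Y ⟶ V.Y}
    (h : N.IsRestriction V k) : N.str = k ≫ V.str := by
  rw [str, h.1]
  simp [str, timesP1]

theorem smooth_snd (Z : Cycle pt ![]) (M : Cycle X r) :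
    SmoothOfRelativeDimension Z.dim (Limits.pullback.snd Z.str M.str) := by
  have := smoothOfRelativeDimension_isStableUnderBaseChange Z.dim
  exact MorphismProperty.of_isPullback (P := @SmoothOfRelativeDimension Z.dim)
    (.of_hasPullback Z.str M.str) Z.smooth

theorem smooth_fst (Z : Cycle pt ![]) (M : Cycle X r) :
    SmoothOfRelativeDimension M.dim (Limits.pullback.fst Z.str M.str) := by
  have := smoothOfRelativeDimension_isStableUnderBaseChange M.dim
  exact MorphismProperty.of_isPullback (P := @SmoothOfRelativeDimension M.dim)
    (IsPullback.of_hasPullback Z.str M.str).flip M.smooth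

theorem prod_isDoublePointRelation_right (Z : Cycle pt ![]) {F A B P : Cycle X r}
    (h : IsDoublePointRelation F A B P) :
    IsDoublePointRelation (Z.prod F) (Z.prod A) (Z.prod B) (Z.prod P) := by
  obtain ⟨n, V, a, b, p, c, hV, hF, hA, hB, hP, rF, rA, rB, rP, H⟩ := h
  obtain ⟨c', -, sF⟩ := exists_prod_right Z c rF.str_eq
  obtain ⟨a', -, sA⟩ := exists_prod_right Z a rA.str_eq
  obtain ⟨b', -, sB⟩ := exists_prod_right Z b rB.str_eq
  obtain ⟨p', -, sP⟩ := exists_prod_right Z p rP.str_eq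
  have key : ∀ {N : Cycle X r} {k : N.Y ⟶ V.Y} {k' : (Z.prod N).Y ⟶ (Z.prod V).Y},
      N.IsRestriction V k → IsPullback k' (Limits.pullback.snd Z.str N.str)
        (Limits.pullback.snd Z.str V.str) k → (Z.prod N).IsRestriction (Z.prod V) k' := by
    intro N k k' hN hk
    refine ⟨?_, fun i => ?_⟩
    · change Limits.pullback.snd Z.str N.str ≫ N.f =
        k' ≫ (Limits.pullback.snd Z.str V.str ≫ V.f) ≫ prX X
      rw [hN.1, Category.assoc, ← Category.assoc k', hk.w, Category.assoc]
    · change VecBundle.IsIsomorphic _ ((V.E i).pullback (_ ≫ _))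
      rw [hk.w]; exact (hN.2 i).pullback _
  refine ⟨Z.dim + n, Z.prod V, a', b', p', c', by simp only [hV]; omega, by simp only [hF],
    by simp only [hA], by simp only [hB], by simp only [hP], key rF sF, key rA sA, key rB sB,
    key rP sP, ?_⟩
  rw [prod_str]
  have e : (Z.prod V).f ≫ prP1 X = Limits.pullback.snd Z.str V.str ≫ V.f ≫ prP1 X :=
    Category.assoc _ _ _
  rw [e]
  exact H.baseChange (smooth_snd Z V) sA sB sP sF

theorem timesP1_pt_hom : (timesP1 pt).hom = prX pt := Category.comp_id _

theorem timesP1_pt_hom' : (timesP1 pt).hom = prP1 pt ≫ P1.hom := by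
  rw [← Limits.pullback.condition]; rfl

theorem prodP1_condition (V : Cycle (timesP1 pt) ![]) (M : Cycle X r) :
    (Limits.pullback.snd V.str M.str ≫ M.f) ≫ X.hom =
      (Limits.pullback.fst V.str M.str ≫ V.f ≫ prP1 pt) ≫ P1.hom := by
  rw [Category.assoc, Category.assoc, Category.assoc, ← timesP1_pt_hom']
  exact Limits.pullback.condition.symm

theorem prodP1_str (V : Cycle (timesP1 pt) ![]) (M : Cycle X r) :
    Limits.pullback.lift (Limits.pullback.snd V.str M.str ≫ M.f)
      (Limits.pullback.fst V.str M.str ≫ V.f ≫ prP1 pt) (prodP1_condition V M) ≫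
        (timesP1 X).hom = Limits.pullback.snd V.str M.str ≫ M.str :=
  (Limits.pullback.lift_fst_assoc _ _ _ _).trans (Category.assoc _ _ _)

/-- `X × ℙ¹` is the product of `pt × ℙ¹` and `X`. -/
theorem isPullback_timesP1 (X : Over SpecC) :
    ∃ q : (timesP1 X).left ⟶ (timesP1 pt).left, q ≫ prP1 pt = prP1 X ∧
      IsPullback q (prX X) (timesP1 pt).hom X.hom := by
  have i : IsIso (prP1 pt) := by
    have : IsIso pt.hom := inferInstanceAs (IsIso (𝟙 SpecC))
    exact inferInstanceAs (IsIso (Limits.pullback.snd pt.hom P1.hom))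
  refine ⟨prP1 X ≫ inv (prP1 pt), by simp, ?_⟩
  rw [timesP1_pt_hom']
  refine IsPullback.of_iso (IsPullback.of_hasPullback X.hom P1.hom).flip (Iso.refl _)
    (asIso (prP1 pt)).symm (Iso.refl _) (Iso.refl _) ?_ ?_ ?_ ?_
  all_goals simp

/-- The product of `V → pt × ℙ¹` and `M → X`, as a family over `X × ℙ¹`. -/
noncomputable abbrev prodP1 (V : Cycle (timesP1 pt) ![]) (M : Cycle X r) : Cycle (timesP1 X) r where
  dim := V.dim + M.dim
  Y := Limits.pullback V.str M.str
  f := Limits.pullback.lift (Limits.pullback.snd V.str M.str ≫ M.f)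
    (Limits.pullback.fst V.str M.str ≫ V.f ≫ prP1 pt) (prodP1_condition V M)
  smooth := smooth_prod (.of_hasPullback V.str M.str)
    (prodP1_str V M) V.smooth M.smooth
  quasiProjective := .prod (.of_hasPullback V.str M.str)
    ((prodP1_str V M).trans Limits.pullback.condition.symm) V.quasiProjective M.quasiProjective
  projective := by
    obtain ⟨q, hq, sq⟩ := isPullback_timesP1 X
    refine .prod sq (.of_hasPullback V.str M.str) ?_ (Limits.pullback.lift_fst _ _ _)
      V.projective M.projective
    have i : IsIso (prP1 pt) := by
      have : IsIso pt.hom := inferInstanceAs (IsIso (𝟙 SpecC))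
      exact inferInstanceAs (IsIso (Limits.pullback.snd pt.hom P1.hom))
    rw [← cancel_mono (prP1 pt), Category.assoc, hq, Category.assoc]
    exact Limits.pullback.lift_snd _ _ _
  E i := (M.E i).pullback (Limits.pullback.snd V.str M.str)

/-- Base change of `N.prod M → V.prodP1 M` along `j : N → V`. -/
theorem exists_prodP1 {N : Cycle pt ![]} {V : Cycle (timesP1 pt) ![]} (j : N.Y ⟶ V.Y)
    (hs : N.str = j ≫ V.str) (M : Cycle X r) : ∃ k : (N.prod M).Y ⟶ (V.prodP1 M).Y,
      k ≫ Limits.pullback.snd V.str M.str = Limits.pullback.snd N.str M.str ∧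
      IsPullback k (Limits.pullback.fst N.str M.str) (Limits.pullback.fst V.str M.str) j := by
  refine ⟨Limits.pullback.lift (Limits.pullback.fst _ _ ≫ j) (Limits.pullback.snd _ _) ?_,
    Limits.pullback.lift_snd _ _ _, ?_⟩
  · rw [Category.assoc, ← hs, Limits.pullback.condition]
  · refine IsPullback.of_right (t := (IsPullback.of_hasPullback V.str M.str).flip) ?_ ?_
    · rw [Limits.pullback.lift_snd, ← hs]; exact (IsPullback.of_hasPullback _ _).flip
    · exact Limits.pullback.lift_fst _ _ _

theorem prod_isDoublePointRelation_left {F A B P : Cycle pt ![]}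
    (h : IsDoublePointRelation F A B P) (M : Cycle X r) :
    IsDoublePointRelation (F.prod M) (A.prod M) (B.prod M) (P.prod M) := by
  obtain ⟨n, V, a, b, p, c, hV, hF, hA, hB, hP, rF, rA, rB, rP, H⟩ := h
  obtain ⟨c', eF, sF⟩ := exists_prodP1 c rF.str_eq M
  obtain ⟨a', eA, sA⟩ := exists_prodP1 a rA.str_eq M
  obtain ⟨b', eB, sB⟩ := exists_prodP1 b rB.str_eq M
  obtain ⟨p', eP, sP⟩ := exists_prodP1 p rP.str_eq M
  have key : ∀ {N : Cycle pt ![]} {k' : (N.prod M).Y ⟶ (V.prodP1 M).Y},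
      k' ≫ Limits.pullback.snd V.str M.str = Limits.pullback.snd N.str M.str →
        (N.prod M).IsRestriction (V.prodP1 M) k' := by
    intro N k' hk
    refine ⟨?_, fun i => ?_⟩
    · rw [Limits.pullback.lift_fst, ← Category.assoc, hk]
    · change VecBundle.IsIsomorphic _ ((M.E i).pullback (_ ≫ _))
      rw [hk]; exact .refl _
  refine ⟨M.dim + n, V.prodP1 M, a', b', p', c', by simp only [hV]; omega,
    by simp only [hF]; omega, by simp only [hA]; omega, by simp only [hB]; omega,
    by simp only [hP]; omega, key eF, key eA, key eB, key eP, ?_⟩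
  have e : (V.prodP1 M).f ≫ prP1 X = Limits.pullback.fst V.str M.str ≫ V.f ≫ prP1 pt :=
    Limits.pullback.lift_snd _ _ _
  have e' : (V.prodP1 M).str = Limits.pullback.fst V.str M.str ≫ V.str := by
    exact (prodP1_str V M).trans Limits.pullback.condition.symm
  rw [e, e']
  refine H.baseChange ?_ sA sB sP sF
  have := smoothOfRelativeDimension_isStableUnderBaseChange M.dim
  exact MorphismProperty.of_isPullback (P := @SmoothOfRelativeDimension M.dim)
    (IsPullback.of_hasPullback V.str M.str).flip M.smooth

theorem prod_assoc (Z Z' : Cycle pt ![]) (M : Cycle X r) :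
    ((Z.prod Z').prod M).IsIsomorphic (Z.prod (Z'.prod M)) := by
  have e : (Z.prod Z').str = Limits.pullback.snd Z.str Z'.str ≫ Z'.str := prod_str Z Z'
  let p₂ : ((Z.prod Z').prod M).Y ⟶ (Z'.prod M).Y :=
    Limits.pullback.lift (Limits.pullback.fst _ _ ≫ Limits.pullback.snd Z.str Z'.str)
      (Limits.pullback.snd _ _) (by rw [Category.assoc, ← e, Limits.pullback.condition])
  have h₁ : p₂ ≫ Limits.pullback.fst Z'.str M.str =
    Limits.pullback.fst _ _ ≫ Limits.pullback.snd Z.str Z'.str := Limits.pullback.lift_fst _ _ _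
  have h₂ : p₂ ≫ Limits.pullback.snd Z'.str M.str = Limits.pullback.snd (Z.prod Z').str M.str :=
    Limits.pullback.lift_snd _ _ _
  have sq : IsPullback p₂ (Limits.pullback.fst (Z.prod Z').str M.str)
      (Limits.pullback.fst Z'.str M.str) (Limits.pullback.snd Z.str Z'.str) := by
    refine IsPullback.of_right (t := (IsPullback.of_hasPullback Z'.str M.str).flip) ?_ h₁
    rw [h₂, ← e]
    exact (IsPullback.of_hasPullback _ _).flip
  refine isIsomorphic_prod (p₁ := Limits.pullback.fst _ _ ≫ Limits.pullback.fst Z.str Z'.str)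
    (p₂ := p₂) ?_ ?_ fun i => ?_
  · rw [prod_str Z' M, ← Limits.pullback.condition]
    exact sq.flip.paste_horiz (IsPullback.of_hasPullback Z.str Z'.str)
  · rw [← Category.assoc, h₂]
  · change VecBundle.IsIsomorphic _ ((M.E i).pullback (_ ≫ _))
    rw [h₂]; exact .refl _

theorem prod_comm (Z Z' : Cycle pt ![]) : (Z.prod Z').IsIsomorphic (Z'.prod Z) := by
  refine isIsomorphic_prod (IsPullback.of_hasPullback Z.str Z'.str).flip ?_ fun i => i.elim0
  have h := Limits.pullback.condition (f := Z.str) (g := Z'.str)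
  have e : Z.str = Z.f := Category.comp_id _
  have e' : Z'.str = Z'.f := Category.comp_id _
  change Limits.pullback.snd _ _ ≫ Z'.f = Limits.pullback.fst _ _ ≫ Z.f
  rw [← e, ← e', h]

/-- The trivial line bundle. -/
noncomputable abbrev trivialLine (Y : Scheme.{0}) : VecBundle Y 1 where
  I := Unit
  U _ := ⊤
  covers _ := ⟨(), trivial⟩
  g _ _ := 1
  cocycle _ _ _ := by simp

theorem relativelyAmple_id (Y : Scheme.{0}) [IsAffine Y] :
    RelativelyAmple (𝟙 Y) (trivialLine Y) := by
  intro y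
  have key : ∀ O : Y.Opens, O = ⊤ → ∀ y : Y, ∃ k > 0, ∃ σ : PowSection (trivialLine Y) k O,
      y ∈ σ.nonvanishing ∧ IsAffineOpen σ.nonvanishing := by
    rintro O rfl y
    let σ : PowSection (trivialLine Y) 1 ⊤ := ⟨fun _ => 1, fun i j => by
      have h : (trivialLine Y).u i j = 1 := rfl
      rw [h, map_one, one_pow, one_mul]⟩
    refine ⟨1, one_pos, σ, ?_⟩
    have : σ.nonvanishing = ⊤ := by
      have h : ∀ i, Y.basicOpen (σ.s i) = ⊤ := fun i => by
        rw [Scheme.basicOpen_of_isUnit _ isUnit_one]; exact inf_idem _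
      rw [PowSection.nonvanishing, iSup_congr h]
      exact iSup_const
    rw [this]
    exact ⟨trivial, isAffineOpen_top Y⟩
  exact ⟨⊤, trivial, isAffineOpen_top Y, fun y _ => key _ rfl y⟩

/-- The class of a point. -/
noncomputable abbrev unit : Cycle pt ![] where
  dim := 0
  Y := SpecC
  f := 𝟙 SpecC
  smooth := by
    have : IsOpenImmersion (𝟙 SpecC ≫ pt.hom) :=
      inferInstanceAs (IsOpenImmersion (𝟙 SpecC ≫ 𝟙 SpecC))
    infer_instance
  quasiProjective := by
    have e : 𝟙 SpecC ≫ pt.hom = 𝟙 SpecC := Category.comp_id _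
    rw [e]
    exact ⟨inferInstance, inferInstance, _, relativelyAmple_id _⟩
  projective := ⟨inferInstanceAs (IsProper (𝟙 SpecC)), _, relativelyAmple_id _⟩
  E i := i.elim0

theorem unit_prod (M : Cycle X r) : M.IsIsomorphic (unit.prod M) := by
  refine isIsomorphic_prod (p₁ := M.str) (p₂ := 𝟙 M.Y) ?_ (Category.id_comp _).symm
    fun i => .refl _
  have e : unit.str = 𝟙 SpecC := Category.comp_id _
  rw [e]
  exact IsPullback.of_vert_isIso ⟨by simp⟩

end Cycle

namespace Omega
variable {X : Over SpecC} {s : ℕ} {r : Fin s → ℕ}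

/-- Multiplication by the class of a smooth projective variety. -/
noncomputable def mulCycle (Z : Cycle pt ![]) : Omega X r →+ Omega X r :=
  lift (fun M => of (Z.prod M)) (fun _ _ h => of_eq_of_iso (h.prod_right Z))
    (fun _ _ _ h => of_disjointUnion (h.prod_right Z))
    (fun _ _ _ _ h => of_doublePoint (Cycle.prod_isDoublePointRelation_right Z h))

theorem mulCycle_of (Z : Cycle pt ![]) (M : Cycle X r) : mulCycle Z (of M) = of (Z.prod M) :=
  lift_of _ _ _ _ _

/-- The product `ω_*(ℂ) × ω_{*,r}(X) → ω_{*,r}(X)`. -/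
noncomputable def act : Omega pt ![] →+ Omega X r →+ Omega X r :=
  lift mulCycle
    (fun _ _ h => hom_ext fun M => by
      rw [mulCycle_of, mulCycle_of]; exact of_eq_of_iso (h.prod_left M))
    (fun _ _ _ h => hom_ext fun M => by
      rw [AddMonoidHom.add_apply, mulCycle_of, mulCycle_of, mulCycle_of]
      exact of_disjointUnion (h.prod_left M))
    (fun _ _ _ _ h => hom_ext fun M => by
      rw [AddMonoidHom.add_apply, AddMonoidHom.sub_apply, AddMonoidHom.sub_apply, mulCycle_of,
        mulCycle_of, mulCycle_of, mulCycle_of]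
      exact of_doublePoint (Cycle.prod_isDoublePointRelation_left h M))

theorem act_of (Z : Cycle pt ![]) (M : Cycle X r) : act (of Z) (of M) = of (Z.prod M) := by
  rw [act, lift_of, mulCycle_of]

theorem induction {p : Omega X r → Prop} (hof : ∀ M, p (of M)) (hneg : ∀ x, p x → p (-x))
    (hadd : ∀ x y, p x → p y → p (x + y)) (h0 : p 0) (x : Omega X r) : p x := by
  have hx : x ∈ AddSubgroup.closure (Set.range (of : Cycle X r → Omega X r)) := by
    let C := AddSubgroup.closure (Set.range (of : Cycle X r → Omega X r))
    have : QuotientAddGroup.mk' C = (0 : Omega X r →+ Omega X r ⧸ C) := by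
      refine hom_ext (G := Omega X r ⧸ C) fun M => ?_
      exact (QuotientAddGroup.eq_zero_iff (of M)).2 (AddSubgroup.subset_closure ⟨M, rfl⟩)
    exact (QuotientAddGroup.eq_zero_iff (N := C) x).1 (DFunLike.congr_fun this x)
  induction hx using AddSubgroup.closure_induction with
  | mem x h => obtain ⟨M, rfl⟩ := h; exact hof M
  | zero => exact h0
  | add x y _ _ h1 h2 => exact hadd _ _ h1 h2
  | neg x _ h => exact hneg _ h

theorem act_act (a b : Omega pt ![]) (x : Omega X r) : act (act a b) x = act a (act b x) := by
  induction a using induction with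
  | hof Z =>
    induction b using induction with
    | hof Z' =>
      induction x using induction with
      | hof M => rw [act_of, act_of, act_of, act_of]; exact of_eq_of_iso (Cycle.prod_assoc Z Z' M)
      | hneg x h => simp only [map_neg, h]
      | hadd x y h h' => simp only [map_add, h, h']
      | h0 => simp only [map_zero]
    | hneg x h => simp only [map_neg, AddMonoidHom.neg_apply, h]
    | hadd x y h h' => simp only [map_add, AddMonoidHom.add_apply, h, h']
    | h0 => simp only [map_zero, AddMonoidHom.zero_apply]
  | hneg x h => simp only [map_neg, AddMonoidHom.neg_apply, h]
  | hadd x y h h' => simp only [map_add, AddMonoidHom.add_apply, h, h']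
  | h0 => simp only [map_zero, AddMonoidHom.zero_apply]

theorem act_comm (a b : Omega pt ![]) : act a b = act b a := by
  induction a using induction with
  | hof Z =>
    induction b using induction with
    | hof Z' => rw [act_of, act_of]; exact of_eq_of_iso (Cycle.prod_comm Z Z')
    | hneg x h => simp only [map_neg, AddMonoidHom.neg_apply, h]
    | hadd x y h h' => simp only [map_add, AddMonoidHom.add_apply, h, h']
    | h0 => simp only [map_zero, AddMonoidHom.zero_apply]
  | hneg x h => simp only [map_neg, AddMonoidHom.neg_apply, h]
  | hadd x y h h' => simp only [map_add, AddMonoidHom.add_apply, h, h']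
  | h0 => simp only [map_zero, AddMonoidHom.zero_apply]

theorem act_one (x : Omega X r) : act (of Cycle.unit) x = x := by
  induction x using induction with
  | hof M => rw [act_of]; exact (of_eq_of_iso (Cycle.unit_prod M)).symm
  | hneg x h => simp only [map_neg, h]
  | hadd x y h h' => simp only [map_add, h, h']
  | h0 => simp only [map_zero]

/-- The ring `ω_*(ℂ)`, with `[Z] · [Z'] = [Z × Z']`. -/
noncomputable instance : CommRing (Omega pt ![]) where
  __ := (inferInstance : AddCommGroup (Omega pt ![]))
  mul a b := act a b
  one := of Cycle.unit
  left_distrib a b c := map_add (act a) b c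
  right_distrib a b c := by
    change act (a + b) c = act a c + act b c
    rw [map_add, AddMonoidHom.add_apply]
  zero_mul a := by
    change act 0 a = 0
    rw [map_zero, AddMonoidHom.zero_apply]
  mul_zero a := map_zero (act a)
  mul_assoc a b c := act_act a b c
  one_mul a := act_one a
  mul_one a := (act_comm a _).trans (act_one a)
  mul_comm a b := act_comm a b

/-- The `ω_*(ℂ)`-module `ω_{*,r}(X)`, with `[Z] • [f : Y → X, E] = [Z × Y → X, pr₂^* E]`. -/
noncomputable instance : Module (Omega pt ![]) (Omega X r) where
  smul a x := act a x
  one_smul x := act_one x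
  mul_smul a b x := act_act a b x
  smul_zero a := map_zero (act a)
  smul_add a x y := map_add (act a) x y
  add_smul a b x := by
    change act (a + b) x = act a x + act b x
    rw [map_add, AddMonoidHom.add_apply]
  zero_smul x := by
    change act 0 x = 0
    rw [map_zero, AddMonoidHom.zero_apply]

theorem smul_of (Z : Cycle pt ![]) (M : Cycle X r) :
    (of Z : Omega pt ![]) • (of M : Omega X r) = of (Z.prod M) := act_of Z M

end Omega

end Products
end BundleCobordism

/-!
Dualization is defined on transition functions by the contragredient `g ↦ (g⁻¹)ᵀ`, which is an
involutive group homomorphism, natural in the coefficient ring. Multiplicativity shows that an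
isomorphism of bundles `h i a` induces the isomorphism `contra (h i a)` of their duals, and
naturality shows that the dual of a pullback is the pullback of the dual. Hence dualization
preserves isomorphisms, disjoint unions and double point relations: in each case the underlying
schemes and morphisms stay the same (for a double point relation the bundle on the total space `V`
is dualized as well), and only the comparison of the bundles has to be dualized. By the
presentation of `Omega X r` it induces an endomorphism, `Omega.dual`, of the group. It commutes with
exterior products, whose bundles are pullbacks, so it is linear over `ω_*(ℂ)`; it is an involution
since `contra` is.
-/

open CategoryTheory AlgebraicGeometry

namespace BundleCobordism

namespace VecBundle

theorem dual_dual {Y : Scheme.{0}} {r : ℕ} (E : VecBundle Y r) : E.dual.dual = E := by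
  rfl

theorem dual_pullback {T Y : Scheme.{0}} {r : ℕ} (f : T ⟶ Y) (E : VecBundle Y r) :
    (E.pullback f).dual = E.dual.pullback f := by
  unfold dual pullback
  congr 1

theorem IsIsomorphic.dual {Y : Scheme.{0}} {r : ℕ} {E F : VecBundle Y r}
    (h : E.IsIsomorphic F) : E.dual.IsIsomorphic F.dual := by
  obtain ⟨h, hh⟩ := h
  refine ⟨fun i a => contra (h i a), fun i j a b => ?_⟩
  have := congrArg contra (hh i j a b)
  rw [map_mul, map_mul] at this
  simp only [resGL, ← map_contra] at this
  exact this

theorem IsIsomorphic.dual_pullback {T Y : Scheme.{0}} {r : ℕ} {f : T ⟶ Y} {E : VecBundle T r}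
    {F : VecBundle Y r} (h : E.IsIsomorphic (F.pullback f)) :
    E.dual.IsIsomorphic (F.dual.pullback f) :=
  VecBundle.dual_pullback f F ▸ h.dual

end VecBundle

namespace Cycle
variable {X : Over SpecC} {s : ℕ} {r : Fin s → ℕ}

theorem dual_dual (M : Cycle X r) : M.dual.dual = M := by
  simp only [dual, VecBundle.dual_dual]

theorem dual_prod (Z : Cycle pt ![]) (M : Cycle X r) : (Z.prod M).dual = Z.prod M.dual := by
  simp only [dual, VecBundle.dual_pullback]

theorem IsIsomorphic.dual {M N : Cycle X r} (h : M.IsIsomorphic N) :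
    M.dual.IsIsomorphic N.dual := by
  obtain ⟨φ, hφ, hE⟩ := h
  exact ⟨φ, hφ, fun i => (hE i).dual_pullback⟩

theorem IsDisjointUnion.dual {M N₁ N₂ : Cycle X r} (h : M.IsDisjointUnion N₁ N₂) :
    M.dual.IsDisjointUnion N₁.dual N₂.dual := by
  obtain ⟨j₁, j₂, o₁, o₂, hc, h₁, h₂, hE₁, hE₂⟩ := h
  exact ⟨j₁, j₂, o₁, o₂, hc, h₁, h₂, fun i => (hE₁ i).dual_pullback,
    fun i => (hE₂ i).dual_pullback⟩

theorem IsRestriction.dual {N : Cycle X r} {V : Cycle (timesP1 X) r} {k : N.Y ⟶ V.Y}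
    (h : N.IsRestriction V k) : N.dual.IsRestriction V.dual k :=
  ⟨h.1, fun i => (h.2 i).dual_pullback⟩

end Cycle

theorem IsDoublePointRelation.dual {X : Over SpecC} {s : ℕ} {r : Fin s → ℕ} {F A B P : Cycle X r}
    (h : IsDoublePointRelation F A B P) :
    IsDoublePointRelation F.dual A.dual B.dual P.dual := by
  obtain ⟨n, V, a, b, p, c, hV, hF, hA, hB, hP, rF, rA, rB, rP, H⟩ := h
  exact ⟨n, V.dual, a, b, p, c, hV, hF, hA, hB, hP, rF.dual, rA.dual, rB.dual, rP.dual, H⟩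

namespace Omega
variable {X : Over SpecC} {s : ℕ} {r : Fin s → ℕ}

/-- The endomorphism `[f : Y → X, (E_i)_i] ↦ [f : Y → X, (E_i^∨)_i]` of the cobordism group, which
dualizes all the bundles of the list. -/
def dual : Omega X r →+ Omega X r :=
  lift (fun M => of M.dual) (fun _ _ h => of_eq_of_iso h.dual)
    (fun _ _ _ h => of_disjointUnion h.dual) (fun _ _ _ _ h => of_doublePoint h.dual)

theorem dual_of (M : Cycle X r) : dual (of M) = of M.dual :=
  lift_of _ _ _ _ _

theorem dual_dual (x : Omega X r) : dual (dual x) = x := by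
  have h : dual.comp dual = AddMonoidHom.id (Omega X r) := hom_ext fun M => by
    rw [AddMonoidHom.comp_apply, dual_of, dual_of, Cycle.dual_dual, AddMonoidHom.id_apply]
  exact DFunLike.congr_fun h x

theorem dual_smul (a : Omega pt ![]) (x : Omega X r) : dual (a • x) = a • dual x := by
  induction a using induction with
  | hof Z =>
    induction x using induction with
    | hof M => rw [dual_of, smul_of, smul_of, dual_of, Cycle.dual_prod]
    | hneg x h => rw [smul_neg, map_neg, map_neg, smul_neg, h]
    | hadd x y h h' => rw [smul_add, map_add, map_add, smul_add, h, h']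
    | h0 => rw [smul_zero, map_zero, smul_zero]
  | hneg a h => rw [neg_smul, neg_smul, map_neg, h]
  | hadd a b h h' => rw [add_smul, add_smul, map_add, h, h']
  | h0 =>
    change dual (act 0 x) = act 0 (dual x)
    rw [map_zero, AddMonoidHom.zero_apply, AddMonoidHom.zero_apply, map_zero]

/-- Dualization as an automorphism of the `ω_*(ℂ)`-module `ω_{*,r}(X)`. -/
noncomputable def dualEquiv : Omega X r ≃ₗ[Omega pt ![]] Omega X r :=
  LinearEquiv.ofInvolutive { dual with map_smul' := dual_smul } dual_dual

theorem dualEquiv_of (M : Cycle X r) : dualEquiv (of M) = of M.dual := dual_of M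

end Omega

end BundleCobordism

theorem proposition2p2 (X : Over BundleCobordism.SpecC) [IsSeparated X.hom]
    [LocallyOfFiniteType X.hom] [QuasiCompact X.hom] (r : ℕ) :
    (∃ τ : BundleCobordism.Omega X ![r] ≃ₗ[BundleCobordism.Omega BundleCobordism.pt ![]]
        BundleCobordism.Omega X ![r],
      (∀ M : BundleCobordism.Cycle X ![r],
        τ (BundleCobordism.Omega.of M) = BundleCobordism.Omega.of M.dual) ∧
      ∀ x, τ (τ x) = x) ∧
    ∀ (k l : ℕ) (a : Fin k → ℤ) (b : Fin l → ℤ) (M : Fin k → BundleCobordism.Cycle X ![r])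
      (N : Fin l → BundleCobordism.Cycle X ![r]),
      ∑ i, a i • BundleCobordism.Omega.of (M i) = ∑ j, b j • BundleCobordism.Omega.of (N j) →
      ∑ i, a i • BundleCobordism.Omega.of (M i).dual =
        ∑ j, b j • BundleCobordism.Omega.of (N j).dual := by
  refine ⟨⟨BundleCobordism.Omega.dualEquiv, BundleCobordism.Omega.dualEquiv_of,
    BundleCobordism.Omega.dual_dual⟩, fun k l a b M N h => ?_⟩
  have := congrArg BundleCobordism.Omega.dual h
  simpa only [map_sum, map_zsmul, BundleCobordism.Omega.dual_of] using this
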